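/- Let $N_0$ be a positive integer and let $(M_N)_{N\ge N_0}$ be positive integers with $M_N\to\infty$. For every $N\ge N_0$ let $\widetilde A^{(N)}\in\mathbb R^{M_N\times N}$ be a random matrix (the probability space may depend on $N$) whose entries are independent and satisfy $\widetilde A^{(N)}_{i,j}\in[a,b]$ almost surely for all $i,j$, where $0<a\le b$ are constants independent of $N$; put $A^{(N)}=\mathbb E[\widetilde A^{(N)}]$. Let $\mathbf r^{(N)}\in\mathbb R^{M_N}$ and $\mathbf c^{(N)}\in\mathbb R^{N}$ be vectors with positive entries such that $\sum_i r^{(N)}_i=\sum_j c^{(N)}_j$, and suppose that there is a constant $C$ independent of $N$ with $$\frac{\max_i r^{(N)}_i}{\min_i r^{(N)}_i}\le C,\qquad \frac{\max_j c^{(N)}_j}{\min_j c^{(N)}_j}\le C\qquad\text{for all } N\ge N_0 .$$ Then there is a unique matrix $P^{(N)}$ of the form $D(\mathbf x)A^{(N)}D(\mathbf y)$, with positive vectors $\mathbf x,\mathbf y$ and $D(\cdot)$ denoting diagonal matrices, that has row sums $\mathbf r^{(N)}$ and column sums $\mathbf c^{(N)}$, and almost surely there is a unique matrix $\widetilde P^{(N)}$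 of the form $D(\widetilde{\mathbf x})\widetilde A^{(N)}D(\widetilde{\mathbf y})$, with positive $\widetilde{\mathbf x},\widetilde{\mathbf y}$, that has these row and column sums. Moreover, with $\|\cdot\|_2$ the operator norm induced by the Euclidean norms, $$\frac{\|\widetilde P^{(N)}-P^{(N)}\|_2}{\|P^{(N)}\|_2}=\mathcal O_{\text{w.h.p}}\left(\sqrt{\frac{\log(\max\{M_N,N\})}{\min\{M_N,N\}}}\right),$$ where $X_N=\mathcal O_{\text{w.h.p}}(\gamma_N)$ means that there is a constant $K$ such that $\lim_{N\to\infty}\Pr\{X_N\le K\gamma_N\}=1$. -/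

import Mathlib

open MeasureTheory ProbabilityTheory Filter Topology

-- `‖B‖` for a real matrix `B` is the operator norm induced by the Euclidean norms.
open scoped Matrix.Norms.L2Operator

namespace RandomScaling

/-- The pair `(x, y)` scales `A` to row sums `r` and column sums `c`. -/
def Scales {m n : ℕ} (x : Fin m → ℝ) (y : Fin n → ℝ) (A : Matrix (Fin m) (Fin n) ℝ)
    (r : Fin m → ℝ) (c : Fin n → ℝ) : Prop :=
  (∀ i, r i = ∑ j, x i * A i j * y j) ∧ (∀ j, c j = ∑ i, x i * A i j * y j)

/-- `P = D(x) A D(y)` for some pair of positive vectors `(x, y)` that scales `A` to row sums `r`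
and column sums `c`. -/
def IsScaledMatrix {m n : ℕ} (A : Matrix (Fin m) (Fin n) ℝ) (r : Fin m → ℝ) (c : Fin n → ℝ)
    (P : Matrix (Fin m) (Fin n) ℝ) : Prop :=
  ∃ (x : Fin m → ℝ) (y : Fin n → ℝ), (∀ i, 0 < x i) ∧ (∀ j, 0 < y j) ∧ Scales x y A r c ∧
    P = Matrix.diagonal x * A * Matrix.diagonal y

/-- The entrywise expectation of a random matrix. -/
noncomputable def expectation {Ω : Type*} [MeasurableSpace Ω] {m n : ℕ} (μ : Measure Ω)
    (A : Ω → Matrix (Fin m) (Fin n) ℝ) : Matrix (Fin m) (Fin n) ℝ :=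
  Matrix.of fun i j => ∫ ω, A ω i j ∂μ

/-- `X_N = O_whp(γ_N)`: there is a constant `K` with `Pr {X_N ≤ K γ_N} → 1`. The random variables
`X_N` may live on different probability spaces. -/
def IsBigOWhp {Ω : ℕ → Type*} [∀ N, MeasurableSpace (Ω N)] (μ : ∀ N, Measure (Ω N))
    (X : ∀ N, Ω N → ℝ) (γ : ℕ → ℝ) : Prop :=
  ∃ K : ℝ, Tendsto (fun N => μ N {ω | X N ω ≤ K * γ N}) atTop (𝓝 1)

end RandomScaling

/-! Existence of a scaling is variational: a minimizer of the potential `scalingPotential` gives the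
row factors (`exists_scaling`). Uniqueness and the perturbation bound both come from
`scaling_stability`: if `D(x) B D(y)` has row and column sums with relative error at most `ε`, then
it differs from the exact scaling of `B` by a relative error `O(ε)` in every entry. The reason is
that a Sinkhorn half step replaces the correction factors by reciprocals of weighted averages.
Entries in `[a, b]` make this a contraction of the ratios of the factors with rate `1 - a / b`, so a
defect `ε` can spread them only by a multiple of `ε`.

Now let `(x, y)` scale the expectation `A`. These factors are deterministic, so `(Ã - A) y` is
linear in independent bounded entries, and Hoeffding bounds its coordinates by `√(log L) ‖y‖₂`, with
`L = max m n`. Balanced sums make `y` balanced, hence `‖y‖₂` is of order `‖y‖₁ / √n`, and similarly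
for `x`: the defect `ε` of `Q = D(x) Ã D(y)` is `O(√(log L / min m n))`.

The error splits at `Q` in `opNorm_scaled_sub_le`. The part `P̃ - Q` is controlled entrywise by
stability. The part `Q - P = D(x) (Ã - A) D(y)` uses `‖Ã - A‖ = O(√(L log L))`, from Hoeffding and a
union bound over a grid (`measureReal_opNorm_le`), against the lower bound for `‖P‖` obtained by
testing on constant vectors. As `m * n = L * min m n`, both parts have the same rate. -/

namespace RandomScaling

/-! ### Contraction of Sinkhorn ratios and stability of scalings. -/

section Stability

variable {ι κ : Type*} [Fintype κ]

/-- An average with weights proportional to `w j * y j`, `w j ∈ [a, b]`, contains the average with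
weights proportional to `y j` with coefficient at least `a / b`. -/
lemma weighted_average_mem_Icc [Nonempty κ] {a b lo hi : ℝ} (ha : 0 < a) {w y q : κ → ℝ}
    (hw : ∀ j, w j ∈ Set.Icc a b) (hy : ∀ j, 0 < y j) (hlo : ∀ j, lo ≤ q j) (hhi : ∀ j, q j ≤ hi) :
    (∑ j, w j * y j * q j) / ∑ j, w j * y j ∈
      Set.Icc (a / b * ((∑ j, y j * q j) / ∑ j, y j) + (1 - a / b) * lo)
        (a / b * ((∑ j, y j * q j) / ∑ j, y j) + (1 - a / b) * hi) := by
  have hw0 : ∀ j, 0 < w j := fun j => ha.trans_le (hw j).1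
  have hb : 0 < b := by
    obtain ⟨j⟩ := ‹Nonempty κ›
    exact (hw0 j).trans_le (hw j).2
  set Y := ∑ j, y j with hYdef
  set W := ∑ j, w j * y j with hWdef
  have hY : 0 < Y := Finset.sum_pos (fun j _ => hy j) Finset.univ_nonempty
  have hW : 0 < W := Finset.sum_pos (fun j _ => mul_pos (hw0 j) (hy j)) Finset.univ_nonempty
  have hWb : W ≤ b * Y := by
    rw [hWdef, hYdef, Finset.mul_sum]
    exact Finset.sum_le_sum fun j _ => mul_le_mul_of_nonneg_right (hw j).2 (hy j).le
  -- The normalized weights dominate `a / b` times the normalized `y`, as `w j ≥ a` and `W ≤ b * Y`.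
  -- The leftover weights are nonnegative with total `1 - a / b`.
  have hcoef : ∀ j, 0 ≤ w j * y j / W - a / b * (y j / Y) := by
    intro j
    rw [sub_nonneg, div_mul_div_comm]
    exact div_le_div₀ (mul_pos (hw0 j) (hy j)).le
      (mul_le_mul_of_nonneg_right (hw j).1 (hy j).le) hW hWb
  have hsum : ∑ j, (w j * y j / W - a / b * (y j / Y)) = 1 - a / b := by
    rw [Finset.sum_sub_distrib, ← Finset.mul_sum, ← Finset.sum_div, ← Finset.sum_div,
      ← hWdef, ← hYdef, div_self hW.ne', div_self hY.ne', mul_one]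
  have hdecomp : (∑ j, w j * y j * q j) / W = a / b * ((∑ j, y j * q j) / Y) +
      ∑ j, (w j * y j / W - a / b * (y j / Y)) * q j := by
    simp only [sub_mul, Finset.sum_sub_distrib, Finset.sum_div, Finset.mul_sum]
    rw [← sub_eq_iff_eq_add']
    congr 1 <;> refine Finset.sum_congr rfl fun j _ => by ring
  rw [hdecomp, ← hsum, Finset.sum_mul, Finset.sum_mul]
  exact ⟨add_le_add_right (Finset.sum_le_sum fun j _ =>
      mul_le_mul_of_nonneg_left (hlo j) (hcoef j)) _,
    add_le_add_right (Finset.sum_le_sum fun j _ =>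
      mul_le_mul_of_nonneg_left (hhi j) (hcoef j)) _⟩

/-- Averaging with weights comparable to a common one contracts ratios towards `1`. -/
lemma weighted_average_le_mul [Nonempty κ] {a b R : ℝ} (ha : 0 < a) {w w' y q : κ → ℝ}
    (hw : ∀ j, w j ∈ Set.Icc a b) (hw' : ∀ j, w' j ∈ Set.Icc a b) (hy : ∀ j, 0 < y j)
    (hR : ∀ j k, q j ≤ R * q k) (hR1 : 1 ≤ R) :
    (∑ j, w j * y j * q j) / ∑ j, w j * y j ≤
      (1 + (1 - a / b) * (R - 1)) * ((∑ j, w' j * y j * q j) / ∑ j, w' j * y j) := by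
  obtain ⟨k, hk⟩ := Finite.exists_min q
  have hab : a ≤ b := (hw k).1.trans (hw k).2
  have hκ1 : a / b ≤ 1 := div_le_one_of_le₀ hab (ha.trans_le hab).le
  have hκ0 : 0 ≤ a / b := div_nonneg ha.le (ha.trans_le hab).le
  have h1 := (weighted_average_mem_Icc ha hw hy hk (fun j => hR j k)).2
  have h2 := (weighted_average_mem_Icc ha hw' hy hk (fun j => hR j k)).1
  have hY : 0 < ∑ j, y j := Finset.sum_pos (fun j _ => hy j) Finset.univ_nonempty
  have hm : q k ≤ (∑ j, y j * q j) / ∑ j, y j := by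
    rw [le_div_iff₀ hY, mul_comm, Finset.sum_mul]
    exact Finset.sum_le_sum fun j _ => mul_le_mul_of_nonneg_left (hk j) (hy j).le
  set m := (∑ j, y j * q j) / ∑ j, y j
  set s := a / b
  have hpos : 0 ≤ (1 - s) * (R - 1) := mul_nonneg (by linarith) (by linarith)
  refine h1.trans (le_trans ?_ (mul_le_mul_of_nonneg_left h2 (by linarith)))
  -- This product is exactly the gap between the two sides, since both averages share the term `s *
  -- m`.
  have : 0 ≤ (1 - s) * (R - 1) * (s * (m - q k)) :=
    mul_nonneg hpos (mul_nonneg hκ0 (by linarith))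
  nlinarith

/-- Two row scalings of matrices with entries in `[a, b]` to the same row sums have comparable
ratios. -/
lemma row_scaling_ratio_le_sq [Nonempty κ] {a b : ℝ} (ha : 0 < a) {A B : ι → κ → ℝ}
    (hA : ∀ i j, A i j ∈ Set.Icc a b) (hB : ∀ i j, B i j ∈ Set.Icc a b) {x x' r : ι → ℝ}
    {y y' : κ → ℝ} (hx : ∀ i, 0 < x i) (hy : ∀ j, 0 < y j)
    (hy' : ∀ j, 0 < y' j) (h : ∀ i, r i = ∑ j, x i * A i j * y j)
    (h' : ∀ i, r i = ∑ j, x' i * B i j * y' j) (i k : ι) :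
    x' i / x i ≤ (b / a) ^ 2 * (x' k / x k) := by
  have hb : 0 < b := by
    obtain ⟨j⟩ := ‹Nonempty κ›
    exact ha.trans_le ((hA i j).1.trans (hA i j).2)
  have bounds : ∀ {D : ι → κ → ℝ} {z : κ → ℝ}, (∀ i j, D i j ∈ Set.Icc a b) → (∀ j, 0 < z j) →
      ∀ i, a * ∑ j, z j ≤ ∑ j, D i j * z j ∧ ∑ j, D i j * z j ≤ b * ∑ j, z j := by
    intro D z hD hz i
    simp only [Finset.mul_sum]
    exact ⟨Finset.sum_le_sum fun j _ => mul_le_mul_of_nonneg_right (hD i j).1 (hz j).le,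
      Finset.sum_le_sum fun j _ => mul_le_mul_of_nonneg_right (hD i j).2 (hz j).le⟩
  have hY : 0 < ∑ j, y j := Finset.sum_pos (fun j _ => hy j) Finset.univ_nonempty
  have hY' : 0 < ∑ j, y' j := Finset.sum_pos (fun j _ => hy' j) Finset.univ_nonempty
  -- Equal row sums turn the ratio of factors into a quotient of two sums, each known up to the
  -- factor `b / a`; hence the square.
  have key : ∀ i, x' i / x i = (∑ j, A i j * y j) / ∑ j, B i j * y' j := by
    intro i
    have e := (h i).symm.trans (h' i)
    simp only [mul_assoc, ← Finset.mul_sum] at e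
    rw [div_eq_div_iff (hx i).ne' ((mul_pos ha hY').trans_le (bounds hB hy' i).1).ne']
    linarith
  rw [key, key]
  calc (∑ j, A i j * y j) / ∑ j, B i j * y' j ≤ (b * ∑ j, y j) / (a * ∑ j, y' j) :=
        div_le_div₀ (by positivity) (bounds hA hy i).2 (by positivity) (bounds hB hy' i).1
    _ = (b / a) ^ 2 * ((a * ∑ j, y j) / (b * ∑ j, y' j)) := by field_simp
    _ ≤ _ := by
        have hBk := (mul_pos ha hY').trans_le (bounds hB hy' k).1
        have hAk := (mul_pos ha hY).trans_le (bounds hA hy k).1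
        exact mul_le_mul_of_nonneg_left
          (div_le_div₀ hAk.le (bounds hA hy k).1 hBk (bounds hB hy' k).2) (by positivity)

/-- One half of a Sinkhorn step contracts the ratios of the scaling factors, up to the error of
the approximate scaling. -/
lemma row_ratio_contraction [Nonempty κ] {a b ε R : ℝ} (ha : 0 < a) (hε : 0 ≤ ε)
    {B : ι → κ → ℝ}
    (hB : ∀ i j, B i j ∈ Set.Icc a b) {x p r : ι → ℝ} {y q : κ → ℝ}
    (hx : ∀ i, 0 < x i) (hp : ∀ i, 0 < p i) (hy : ∀ j, 0 < y j) (hq : ∀ j, 0 < q j)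
    (hr : ∀ i, 0 < r i) (hscale : ∀ i, r i = p i * x i * ∑ j, B i j * y j * q j)
    (herr : ∀ i, |x i * ∑ j, B i j * y j - r i| ≤ ε * r i)
    (hlow : ∀ i, a / b * r i ≤ x i * ∑ j, B i j * y j)
    (hR : ∀ j k, q j ≤ R * q k) (hR1 : 1 ≤ R) (i k : ι) :
    p i ≤ (1 + 2 * (b / a) * ε) * (1 + (1 - a / b) * (R - 1)) * p k := by
  have hab : a ≤ b := by
    obtain ⟨j⟩ := ‹Nonempty κ›
    exact (hB i j).1.trans (hB i j).2
  have hb : 0 < b := ha.trans_le hab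
  have hW : ∀ i, 0 < ∑ j, B i j * y j := fun i =>
    Finset.sum_pos (fun j _ => mul_pos (ha.trans_le (hB i j).1) (hy j)) Finset.univ_nonempty
  have hWq : ∀ i, 0 < ∑ j, B i j * y j * q j := fun i =>
    Finset.sum_pos (fun j _ => mul_pos (mul_pos (ha.trans_le (hB i j).1) (hy j)) (hq j))
      Finset.univ_nonempty
  -- The correction `p i` is the reciprocal of `ρ i * F i`: the relative row sum of the approximate
  -- scaling times a weighted average of `q`. Ratios of `p` are therefore ratios of `ρ * F` with the
  -- indices exchanged.
  set F : ι → ℝ := fun i => (∑ j, B i j * y j * q j) / ∑ j, B i j * y j with hF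
  set ρ : ι → ℝ := fun i => x i * (∑ j, B i j * y j) / r i with hρ
  have hFpos : ∀ i, 0 < F i := fun i => div_pos (hWq i) (hW i)
  have hρpos : ∀ i, 0 < ρ i := fun i => div_pos (mul_pos (hx i) (hW i)) (hr i)
  have hpF : ∀ i, p i * (ρ i * F i) = 1 := by
    intro i
    have h1 := (hW i).ne'
    have h2 := (hr i).ne'
    simp only [hF, hρ]
    field_simp
    rw [hscale i]
  have hFF : F k ≤ (1 + (1 - a / b) * (R - 1)) * F i :=
    weighted_average_le_mul ha (hB k) (hB i) hy hR hR1
  have hρerr : ∀ i, |ρ i - 1| ≤ ε := by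
    intro i
    have : ρ i - 1 = (x i * ∑ j, B i j * y j - r i) / r i := by
      simp only [hρ]; rw [sub_div, div_self (hr i).ne']
    rw [this, abs_div, abs_of_pos (hr i), div_le_iff₀ (hr i)]
    exact herr i
  have hρlow : a / b ≤ ρ i := by
    simp only [hρ]; rw [le_div_iff₀ (hr i)]; exact hlow i
  -- The numbers `ρ` differ by at most `2 * ε`; the lower bound `a / b ≤ ρ i` makes this relative
  -- without requiring `ε` to be small.
  have hρρ : ρ k ≤ (1 + 2 * (b / a) * ε) * ρ i := by
    have h1 := abs_le.1 (hρerr k)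
    have h2 := abs_le.1 (hρerr i)
    have h3 : 2 * (b / a) * ε * (a / b) ≤ 2 * (b / a) * ε * ρ i :=
      mul_le_mul_of_nonneg_left hρlow (by positivity)
    have h4 : 2 * (b / a) * ε * (a / b) = 2 * ε := by field_simp
    nlinarith
  have hκ1 : a / b ≤ 1 := div_le_one_of_le₀ hab hb.le
  have hprod : ρ k * F k ≤ (1 + 2 * (b / a) * ε) * (1 + (1 - a / b) * (R - 1)) * (ρ i * F i) := by
    calc ρ k * F k ≤ ((1 + 2 * (b / a) * ε) * ρ i) * ((1 + (1 - a / b) * (R - 1)) * F i) :=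
          mul_le_mul hρρ hFF (hFpos k).le (mul_nonneg (by positivity) (hρpos i).le)
      _ = _ := by ring
  have h5 := mul_le_mul_of_nonneg_left hprod (mul_pos (hp i) (hp k)).le
  calc p i = p i * p k * (ρ k * F k) := by linear_combination (-p i) * hpF k
    _ ≤ _ := h5
    _ = _ := by
      linear_combination ((1 + 2 * (b / a) * ε) * (1 + (1 - a / b) * (R - 1)) * p k) * hpF i

/-- If `D(x) B D(y)` has approximately the row sums `r` and column sums `c`, then it is entrywise
close to the exactly scaled matrix `D(x') B D(y')`. -/
theorem scaling_stability [Fintype ι] {a b ε : ℝ} (ha : 0 < a) {A B : ι → κ → ℝ}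
    (hA : ∀ i j, A i j ∈ Set.Icc a b) (hB : ∀ i j, B i j ∈ Set.Icc a b) {x x' r : ι → ℝ}
    {y y' c : κ → ℝ} (hx : ∀ i, 0 < x i) (hx' : ∀ i, 0 < x' i) (hy : ∀ j, 0 < y j)
    (hy' : ∀ j, 0 < y' j)
    (hr : ∀ i, r i = ∑ j, x i * A i j * y j) (hc : ∀ j, c j = ∑ i, x i * A i j * y j)
    (hr' : ∀ i, r i = ∑ j, x' i * B i j * y' j) (hc' : ∀ j, c j = ∑ i, x' i * B i j * y' j)
    (hrow : ∀ i, |∑ j, x i * B i j * y j - r i| ≤ ε * r i)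
    (hcol : ∀ j, |∑ i, x i * B i j * y j - c j| ≤ ε * c j) (i : ι) (j : κ) :
    |x' i * y' j - x i * y j| ≤ 3 * (b / a) ^ 4 * ε * (x i * y j) := by
  have : Nonempty ι := ⟨i⟩
  have : Nonempty κ := ⟨j⟩
  have hab : a ≤ b := (hA i j).1.trans (hA i j).2
  have hb : 0 < b := ha.trans_le hab
  have hrpos : ∀ i, 0 < r i := fun i => by
    rw [hr]
    exact Finset.sum_pos (fun j _ => mul_pos (mul_pos (hx i) (ha.trans_le (hA i j).1)) (hy j))
      Finset.univ_nonempty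
  have hcpos : ∀ j, 0 < c j := fun j => by
    rw [hc]
    exact Finset.sum_pos (fun i _ => mul_pos (mul_pos (hx i) (ha.trans_le (hA i j).1)) (hy j))
      Finset.univ_nonempty
  have hε : 0 ≤ ε := by
    have := (abs_nonneg _).trans (hrow i)
    exact nonneg_of_mul_nonneg_left this (hrpos i)
  set p : ι → ℝ := fun i => x' i / x i with hpdef
  set q : κ → ℝ := fun j => y' j / y j with hqdef
  have hp : ∀ i, 0 < p i := fun i => div_pos (hx' i) (hx i)
  have hq : ∀ j, 0 < q j := fun j => div_pos (hy' j) (hy j)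
  have hpx : ∀ i, p i * x i = x' i := fun i => div_mul_cancel₀ _ (hx i).ne'
  have hqy : ∀ j, q j * y j = y' j := fun j => div_mul_cancel₀ _ (hy j).ne'
  have hAB : ∀ i j, a / b * A i j ≤ B i j := by
    intro i j
    calc a / b * A i j ≤ a / b * b := mul_le_mul_of_nonneg_left (hA i j).2 (by positivity)
      _ = a := by field_simp
      _ ≤ _ := (hB i j).1
  have rowScale : ∀ i, r i = p i * x i * ∑ j, B i j * y j * q j := by
    intro i
    rw [hr', hpx, Finset.mul_sum]
    refine Finset.sum_congr rfl fun j _ => ?_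
    rw [← hqy j]; ring
  have colScale : ∀ j, c j = q j * y j * ∑ i, B i j * x i * p i := by
    intro j
    rw [hc', hqy, Finset.mul_sum]
    refine Finset.sum_congr rfl fun i _ => ?_
    rw [← hpx i]; ring
  have rowSum : ∀ i, ∑ j, x i * B i j * y j = x i * ∑ j, B i j * y j := by
    intro i; rw [Finset.mul_sum]; exact Finset.sum_congr rfl fun j _ => by ring
  have colSum : ∀ j, ∑ i, x i * B i j * y j = y j * ∑ i, B i j * x i := by
    intro j; rw [Finset.mul_sum]; exact Finset.sum_congr rfl fun i _ => by ring
  have rowLow : ∀ i, a / b * r i ≤ x i * ∑ j, B i j * y j := by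
    intro i
    rw [← rowSum, hr, Finset.mul_sum]
    refine Finset.sum_le_sum fun j _ => ?_
    have := mul_le_mul_of_nonneg_left (hAB i j) (mul_pos (hx i) (hy j)).le
    linarith
  have colLow : ∀ j, a / b * c j ≤ y j * ∑ i, B i j * x i := by
    intro j
    rw [← colSum, hc, Finset.mul_sum]
    refine Finset.sum_le_sum fun i _ => ?_
    have := mul_le_mul_of_nonneg_left (hAB i j) (mul_pos (hx i) (hy j)).le
    linarith
  simp only [rowSum] at hrow
  simp only [colSum] at hcol
  have hp0 : ∀ i k, p i ≤ (b / a) ^ 2 * p k :=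
    row_scaling_ratio_le_sq ha hA hB hx hy hy' hr hr'
  have hq0 : ∀ j k, q j ≤ (b / a) ^ 2 * q k :=
    row_scaling_ratio_le_sq ha (fun j i => hA i j) (fun j i => hB i j) hy hx hx'
      (fun j => (hc j).trans (Finset.sum_congr rfl fun i _ => by ring))
      (fun j => (hc' j).trans (Finset.sum_congr rfl fun i _ => by ring))
  -- Row ratios are controlled by the spread of the column factors and conversely. The larger of the
  -- two spreads is attained on one side, and there the contraction becomes a self-bound for `R`.
  obtain ⟨R, hR1, hRp, hRq, hRβ, hRtight⟩ : ∃ R : ℝ, 1 ≤ R ∧ (∀ i k, p i ≤ R * p k) ∧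
      (∀ j k, q j ≤ R * q k) ∧ R ≤ (b / a) ^ 2 ∧
      ((∃ i k, p i = R * p k) ∨ ∃ j k, q j = R * q k) := by
    obtain ⟨⟨i₁, i₂⟩, hi⟩ := Finite.exists_max fun z : ι × ι => p z.1 / p z.2
    obtain ⟨⟨j₁, j₂⟩, hj⟩ := Finite.exists_max fun z : κ × κ => q z.1 / q z.2
    refine ⟨max (p i₁ / p i₂) (q j₁ / q j₂), ?_, ?_, ?_, ?_, ?_⟩
    · have := hi (i, i)
      simp only [div_self (hp i).ne'] at this
      exact this.trans (le_max_left _ _)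
    · intro i k
      rw [← div_le_iff₀ (hp k)]
      exact (hi (i, k)).trans (le_max_left _ _)
    · intro i k
      rw [← div_le_iff₀ (hq k)]
      exact (hj (i, k)).trans (le_max_right _ _)
    · refine max_le ?_ ?_
      · rw [div_le_iff₀ (hp _)]; exact hp0 _ _
      · rw [div_le_iff₀ (hq _)]; exact hq0 _ _
    · rcases max_choice (p i₁ / p i₂) (q j₁ / q j₂) with h | h
      · exact Or.inl ⟨i₁, i₂, by rw [h, div_mul_cancel₀ _ (hp _).ne']⟩
      · exact Or.inr ⟨j₁, j₂, by rw [h, div_mul_cancel₀ _ (hq _).ne']⟩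
  have hRR : R ≤ (1 + 2 * (b / a) * ε) * (1 + (1 - a / b) * (R - 1)) := by
    rcases hRtight with ⟨i, k, h⟩ | ⟨j, k, h⟩
    · have := row_ratio_contraction ha hε hB hx hp hy hq hrpos rowScale hrow rowLow hRq hR1 i k
      rw [h] at this
      exact le_of_mul_le_mul_right this (hp k)
    · have := row_ratio_contraction ha hε (fun j i => hB i j) hy hq hx hp hcpos colScale hcol
        colLow hRp hR1 j k
      rw [h] at this
      exact le_of_mul_le_mul_right this (hq k)
  set β := b / a with hβ
  have hβ1 : 1 ≤ β := (one_le_div ha).2 hab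
  have hβinv : β * (a / b) = 1 := by rw [hβ]; field_simp
  have hs0 : 0 < a / b := by positivity
  set s := a / b
  -- Solving the self-bound for `R - 1` costs a factor `β`; the a priori bound `R ≤ β ^ 2`
  -- linearizes it for every `ε ≥ 0`.
  have hD : R - 1 ≤ 2 * β ^ 4 * ε := by
    have h1 : s * (R - 1) ≤ 2 * β * ε * (1 + (1 - s) * (R - 1)) := by nlinarith
    have h2 : 1 + (1 - s) * (R - 1) ≤ β ^ 2 := by nlinarith
    have h3 : s * (R - 1) ≤ 2 * β * ε * β ^ 2 :=
      h1.trans (mul_le_mul_of_nonneg_left h2 (by positivity))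
    have h4 := mul_le_mul_of_nonneg_left h3 (by positivity : 0 ≤ β)
    calc R - 1 = β * (s * (R - 1)) := by linear_combination (-(R - 1)) * hβinv
      _ ≤ _ := h4
      _ = _ := by ring
  -- compare `p i * q j` with the weighted average of `p i * q k` over `k`
  set W := x i * ∑ k, B i k * y k with hWdef
  have hW : 0 < W := (mul_pos hs0 (hrpos i)).trans_le (rowLow i)
  have hsum : r i = ∑ k, x i * B i k * y k * (p i * q k) := by
    rw [rowScale i, Finset.mul_sum]; exact Finset.sum_congr rfl fun k _ => by ring
  have hWsum : W = ∑ k, x i * B i k * y k := (rowSum i).symm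
  have hcoef : ∀ k, 0 ≤ x i * B i k * y k := fun k =>
    (mul_pos (mul_pos (hx i) (ha.trans_le (hB i k).1)) (hy k)).le
  have hup : p i * q j * W ≤ R * r i := by
    rw [hsum, hWsum, Finset.mul_sum, Finset.mul_sum]
    refine Finset.sum_le_sum fun k _ => ?_
    have := mul_le_mul_of_nonneg_left (mul_le_mul_of_nonneg_left (hRq j k) (hp i).le) (hcoef k)
    linarith
  have hdown : r i ≤ R * (p i * q j) * W := by
    rw [hsum, hWsum, Finset.mul_sum]
    refine Finset.sum_le_sum fun k _ => ?_
    have := mul_le_mul_of_nonneg_left (mul_le_mul_of_nonneg_left (hRq k j) (hp i).le) (hcoef k)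
    linarith
  have hθ0 : 0 < p i * q j := mul_pos (hp i) (hq j)
  set θ := p i * q j with hθ
  have hWerr := abs_le.1 (hrow i)
  have hlowW : s * r i ≤ W := rowLow i
  have hr_le : r i ≤ (1 + β * ε) * W := by
    have h1 : ε * r i ≤ β * ε * W := by
      have := mul_le_mul_of_nonneg_left hlowW (by positivity : 0 ≤ β * ε)
      calc ε * r i = β * ε * (s * r i) := by linear_combination (-(ε * r i)) * hβinv
        _ ≤ _ := this
    linarith [hWerr.1]
  have hβ3 : β * ε * β ^ 2 ≤ β ^ 4 * ε := by
    have : β ^ 3 ≤ β ^ 4 := pow_le_pow_right₀ hβ1 (by norm_num)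
    nlinarith
  have hβ2 : ε * β ^ 2 ≤ β ^ 4 * ε := by
    have : β ^ 2 ≤ β ^ 4 := pow_le_pow_right₀ hβ1 (by norm_num)
    nlinarith
  have hθup : θ - 1 ≤ 3 * β ^ 4 * ε := by
    have h1 : θ * W ≤ R * ((1 + β * ε) * W) :=
      hup.trans (mul_le_mul_of_nonneg_left hr_le (by linarith))
    have h2 : θ ≤ R * (1 + β * ε) := by
      exact le_of_mul_le_mul_right (by linarith) hW
    have h3 : β * ε * R ≤ β * ε * β ^ 2 := mul_le_mul_of_nonneg_left hRβ (by positivity)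
    linarith
  have hθdown : 1 - θ ≤ 3 * β ^ 4 * ε := by
    -- Only `θ < 1` needs an argument; there `θ * (3 * β ^ 4 * ε)` may be replaced by `3 * β ^ 4 *
    -- ε`.
    by_cases hθ1 : 1 ≤ θ
    · have : 0 ≤ 3 * β ^ 4 * ε := by positivity
      linarith
    have h1 : r i ≤ R * θ * ((1 + ε) * r i) :=
      hdown.trans (mul_le_mul_of_nonneg_left (by linarith [hWerr.2]) (by positivity))
    have h2 : 1 ≤ R * θ * (1 + ε) := by
      have : 1 * r i ≤ R * θ * (1 + ε) * r i := by linarith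
      exact le_of_mul_le_mul_right this (hrpos i)
    have h3 : ε * R ≤ ε * β ^ 2 := mul_le_mul_of_nonneg_left hRβ hε
    have h4 : R * (1 + ε) ≤ 1 + 3 * β ^ 4 * ε := by linarith
    have h5 : θ * (R * (1 + ε)) ≤ θ * (1 + 3 * β ^ 4 * ε) :=
      mul_le_mul_of_nonneg_left h4 hθ0.le
    have h6 : θ * (3 * β ^ 4 * ε) ≤ 1 * (3 * β ^ 4 * ε) :=
      mul_le_mul_of_nonneg_right (by linarith) (by positivity)
    linarith
  have hfin : x' i * y' j - x i * y j = (θ - 1) * (x i * y j) := by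
    rw [← hpx, ← hqy]; ring
  rw [hfin, abs_mul, abs_of_pos (mul_pos (hx i) (hy j))]
  exact mul_le_mul_of_nonneg_right (abs_le.2 ⟨by linarith, hθup⟩) (mul_pos (hx i) (hy j)).le

end Stability

/-! ### Existence of scalings by minimizing a potential. -/

section Existence

variable {ι κ : Type*} [Fintype ι]

/-- The logarithmic potential whose minimizers are the logarithms of the row scaling factors. -/
noncomputable def scalingPotential [Fintype κ] (A : ι → κ → ℝ) (r : ι → ℝ) (c : κ → ℝ)
    (u : ι → ℝ) : ℝ :=
  ∑ j, c j * Real.log (∑ i, A i j * Real.exp (u i)) - ∑ i, r i * u i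

lemma sum_mul_exp_pos [Nonempty ι] {A : ι → κ → ℝ} (hA : ∀ i j, 0 < A i j) (u : ι → ℝ) (j : κ) :
    0 < ∑ i, A i j * Real.exp (u i) :=
  Finset.sum_pos (fun i _ => mul_pos (hA i j) (Real.exp_pos _)) Finset.univ_nonempty

lemma continuous_scalingPotential [Fintype κ] [Nonempty ι] {A : ι → κ → ℝ} (hA : ∀ i j, 0 < A i j)
    (r : ι → ℝ) (c : κ → ℝ) : Continuous (scalingPotential A r c) := by
  unfold scalingPotential
  refine Continuous.sub (continuous_finsetSum _ fun j _ => continuous_const.mul ?_) (by fun_prop)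
  exact Continuous.log (by fun_prop) fun u => (sum_mul_exp_pos hA u j).ne'

/-- A shift by `t` adds `t * ∑ c` to the logarithmic part and `t * ∑ r` to the linear part. Equal
totals cancel, which is the freedom `(x, y) ↦ (s x, y / s)`. -/
lemma scalingPotential_add_const [Fintype κ] [Nonempty ι] {A : ι → κ → ℝ} (hA : ∀ i j, 0 < A i j)
    {r : ι → ℝ} {c : κ → ℝ} (hrc : ∑ i, r i = ∑ j, c j) (u : ι → ℝ) (t : ℝ) :
    scalingPotential A r c (fun i => u i + t) = scalingPotential A r c u := by
  have h : ∀ j, Real.log (∑ i, A i j * Real.exp (u i + t)) =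
      Real.log (∑ i, A i j * Real.exp (u i)) + t := by
    intro j
    have : ∑ i, A i j * Real.exp (u i + t) = (∑ i, A i j * Real.exp (u i)) * Real.exp t := by
      rw [Finset.sum_mul]
      exact Finset.sum_congr rfl fun i _ => by rw [Real.exp_add]; ring
    rw [this, Real.log_mul (sum_mul_exp_pos hA u j).ne' (Real.exp_pos t).ne', Real.log_exp]
  simp only [scalingPotential, h, mul_add, Finset.sum_add_distrib, ← Finset.sum_mul, hrc]
  ring

/-- By shift invariance only vectors with maximum `0` matter. On these the logarithms stay bounded
below while `-∑ r i * u i` grows, so the search reduces to a compact box. -/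
lemma exists_forall_scalingPotential_le [Fintype κ] [Nonempty ι] {A : ι → κ → ℝ}
    (hA : ∀ i j, 0 < A i j) {r : ι → ℝ} {c : κ → ℝ} (hr : ∀ i, 0 < r i) (hc : ∀ j, 0 < c j)
    (hrc : ∑ i, r i = ∑ j, c j) :
    ∃ u, ∀ v, scalingPotential A r c u ≤ scalingPotential A r c v := by
  obtain ⟨i₀, hi₀⟩ := Finite.exists_min r
  -- a lower bound on the potential for vectors with maximum `0`
  have hlow : ∀ j, ∃ a, 0 < a ∧ ∀ i, a ≤ A i j := fun j => by
    obtain ⟨i, hi⟩ := Finite.exists_min fun i => A i j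
    exact ⟨_, hA i j, hi⟩
  choose a ha haA using hlow
  set L := ∑ j, c j * Real.log (a j) with hL
  have bound : ∀ u : ι → ℝ, (∀ i, u i ≤ 0) → (∃ i, u i = 0) → ∀ k,
      L + r i₀ * (-u k) ≤ scalingPotential A r c u := by
    rintro u hu ⟨i, hi⟩ k
    have h1 : L ≤ ∑ j, c j * Real.log (∑ i, A i j * Real.exp (u i)) := by
      refine Finset.sum_le_sum fun j _ => mul_le_mul_of_nonneg_left ?_ (hc j).le
      refine Real.log_le_log (ha j) ((haA j i).trans ?_)
      have := Finset.single_le_sum (f := fun i => A i j * Real.exp (u i))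
        (fun i _ => (mul_pos (hA i j) (Real.exp_pos _)).le) (Finset.mem_univ i)
      simpa [hi] using this
    have h2 : r k * (-u k) ≤ ∑ i, r i * (-u i) :=
      Finset.single_le_sum (f := fun i => r i * (-u i))
        (fun i _ => mul_nonneg (hr i).le (neg_nonneg.2 (hu i))) (Finset.mem_univ k)
    have h3 : r i₀ * (-u k) ≤ r k * (-u k) :=
      mul_le_mul_of_nonneg_right (hi₀ k) (neg_nonneg.2 (hu k))
    simp only [mul_neg, Finset.sum_neg_distrib] at h1 h2 h3 ⊢
    unfold scalingPotential
    linarith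
  -- Chosen so that a normalized vector with a coordinate below `-T` has potential at least that of
  -- `0`, which lies in the box.
  set T := max 0 ((scalingPotential A r c 0 - L) / r i₀) with hT
  have hT0 : 0 ≤ T := le_max_left _ _
  obtain ⟨u, -, hu⟩ := (isCompact_Icc (a := fun _ : ι => -T) (b := fun _ => 0)).exists_isMinOn
    ⟨0, fun _ => by simpa using hT0, fun _ => le_rfl⟩
    (continuous_scalingPotential hA r c).continuousOn
  refine ⟨u, fun v => ?_⟩
  have hu0 : scalingPotential A r c u ≤ scalingPotential A r c 0 :=
    hu ⟨fun _ => by simpa using hT0, fun _ => le_rfl⟩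
  obtain ⟨i, hi⟩ := Finite.exists_max v
  rw [← scalingPotential_add_const hA hrc v (-v i)]
  set w : ι → ℝ := fun k => v k + -v i
  have hw : ∀ k, w k ≤ 0 := fun k => by have := hi k; simp only [w]; linarith
  by_cases hwT : ∀ k, -T ≤ w k
  · exact hu ⟨hwT, hw⟩
  · push Not at hwT
    obtain ⟨k, hk⟩ := hwT
    refine hu0.trans (le_trans ?_ (bound w hw ⟨i, by simp [w]⟩ k))
    have h1 : (scalingPotential A r c 0 - L) / r i₀ ≤ -w k :=
      (le_max_right _ _).trans (lt_neg_of_lt_neg hk).le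
    rw [div_le_iff₀ (hr i₀)] at h1
    linarith

/-- **Sinkhorn's theorem** (existence): a positive matrix can be scaled to prescribed positive row
and column sums with equal totals. -/
theorem exists_scaling [Fintype κ] [Nonempty ι] {A : ι → κ → ℝ} (hA : ∀ i j, 0 < A i j)
    {r : ι → ℝ} {c : κ → ℝ} (hr : ∀ i, 0 < r i) (hc : ∀ j, 0 < c j)
    (hrc : ∑ i, r i = ∑ j, c j) :
    ∃ (x : ι → ℝ) (y : κ → ℝ), (∀ i, 0 < x i) ∧ (∀ j, 0 < y j) ∧
      (∀ i, r i = ∑ j, x i * A i j * y j) ∧ ∀ j, c j = ∑ i, x i * A i j * y j := by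
  classical
  obtain ⟨u, hu⟩ := exists_forall_scalingPotential_le hA hr hc hrc
  set s : κ → ℝ := fun j => ∑ i, A i j * Real.exp (u i) with hs
  have hspos : ∀ j, 0 < s j := sum_mul_exp_pos hA u
  refine ⟨fun i => Real.exp (u i), fun j => c j / s j, fun i => Real.exp_pos _,
    fun j => div_pos (hc j) (hspos j), fun i => ?_, fun j => ?_⟩
  -- Up to a constant, `φ` is the potential along the `i`-th coordinate line through `u`; the
  -- vanishing of its derivative at `0` is the `i`-th row equation. The column equations hold by the
  -- choice of `y`.
  · set φ : ℝ → ℝ := fun t =>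
      ∑ j, c j * Real.log (s j + A i j * Real.exp (u i) * (Real.exp t - 1)) - r i * t with hφ
    have hφu : ∀ t, scalingPotential A r c (Function.update u i (u i + t)) =
        φ t - ∑ k, r k * u k := by
      intro t
      have h1 : ∀ f : ι → ℝ → ℝ, ∑ k, f k (Function.update u i (u i + t) k) =
          ∑ k, f k (u k) + (f i (u i + t) - f i (u i)) := by
        intro f
        rw [← Finset.add_sum_erase _ _ (Finset.mem_univ i),
          ← Finset.add_sum_erase _ (fun k => f k (u k)) (Finset.mem_univ i),
          Finset.sum_congr rfl fun k hk => by
            rw [Function.update_of_ne (Finset.ne_of_mem_erase hk)],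
          Function.update_self]
        ring
      have h2 : ∀ j, ∑ k, A k j * Real.exp (Function.update u i (u i + t) k) =
          s j + A i j * Real.exp (u i) * (Real.exp t - 1) := by
        intro j
        rw [h1 fun k z => A k j * Real.exp z, Real.exp_add]
        ring
      simp only [scalingPotential, h2, h1 fun k z => r k * z, hφ]
      ring
    have hmin : IsLocalMin φ 0 := by
      refine Filter.Eventually.of_forall fun t => ?_
      have h0 := hφu 0
      rw [add_zero, Function.update_eq_self] at h0
      have := hu (Function.update u i (u i + t))
      rw [hφu, h0] at this
      linarith
    have hderiv : HasDerivAt φ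
        (∑ j, c j * (A i j * Real.exp (u i) / s j) - r i) 0 := by
      refine HasDerivAt.sub (HasDerivAt.fun_sum fun j _ => HasDerivAt.const_mul _ ?_) ?_
      · have h1 : HasDerivAt (fun t => s j + A i j * Real.exp (u i) * (Real.exp t - 1))
            (A i j * Real.exp (u i)) 0 := by
          simpa using (((Real.hasDerivAt_exp 0).sub_const 1).const_mul
            (A i j * Real.exp (u i))).const_add (s j)
        simpa using h1.log (by simpa using (hspos j).ne')
      · simpa using (hasDerivAt_id (0 : ℝ)).const_mul (r i)
    have h0 := hmin.hasDerivAt_eq_zero hderiv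
    rw [← sub_eq_zero.1 h0]
    exact Finset.sum_congr rfl fun j _ => by ring
  · have : ∑ i, Real.exp (u i) * A i j * (c j / s j) = s j * (c j / s j) := by
      rw [hs, Finset.sum_mul]
      exact Finset.sum_congr rfl fun i _ => by ring
    rw [this, mul_div_cancel₀ _ (hspos j).ne']

end Existence

/-- **Sinkhorn's theorem**: existence and uniqueness of the scaled matrix. -/
theorem existsUnique_isScaledMatrix {m n : ℕ} (hm : 0 < m) {a b : ℝ} (ha : 0 < a)
    {A : Matrix (Fin m) (Fin n) ℝ} (hA : ∀ i j, A i j ∈ Set.Icc a b) {r : Fin m → ℝ}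
    {c : Fin n → ℝ} (hr : ∀ i, 0 < r i) (hc : ∀ j, 0 < c j) (hrc : ∑ i, r i = ∑ j, c j) :
    ∃! P, IsScaledMatrix A r c P := by
  have : Nonempty (Fin m) := ⟨⟨0, hm⟩⟩
  obtain ⟨x, y, hx, hy, hxr, hyc⟩ := exists_scaling (A := A)
    (fun i j => ha.trans_le (hA i j).1) hr hc hrc
  refine ⟨_, ⟨x, y, hx, hy, ⟨hxr, hyc⟩, rfl⟩, ?_⟩
  rintro _ ⟨x', y', hx', hy', ⟨hxr', hyc'⟩, rfl⟩
  ext i j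
  -- Stability with no defect forces the products `x i * y j` to agree, though `x` and `y` need not.
  have h := scaling_stability (ε := 0) ha hA hA hx hx' hy hy' hxr hyc hxr' hyc'
    (fun i => by rw [← hxr i]; simp) (fun j => by rw [← hyc j]; simp) i j
  have h' : x' i * y' j = x i * y j := by
    rw [mul_zero, zero_mul] at h
    exact sub_eq_zero.1 (abs_nonpos_iff.1 h)
  simp only [Matrix.mul_diagonal, Matrix.diagonal_mul]
  linear_combination A i j * h'

/-! ### Operator norms through bilinear forms. -/

section OperatorNorm

variable {ι κ : Type*} [Fintype ι] [Fintype κ] [DecidableEq κ]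

lemma inner_toEuclideanLin_eq_sum (B : Matrix ι κ ℝ) (u : ι → ℝ) (v : κ → ℝ) :
    inner ℝ (WithLp.toLp 2 u) (Matrix.toEuclideanLin B (WithLp.toLp 2 v)) =
      ∑ i, ∑ j, u i * B i j * v j := by
  simp only [PiLp.inner_apply, Matrix.toLpLin_toLp, Matrix.toLin'_apply, Matrix.mulVec, dotProduct]
  refine Finset.sum_congr rfl fun i _ => ?_
  rw [RCLike.inner_apply, conj_trivial, Finset.sum_mul]
  exact Finset.sum_congr rfl fun j _ => by ring

lemma abs_sum_sum_mul_le_opNorm (B : Matrix ι κ ℝ) (u : ι → ℝ) (v : κ → ℝ) :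
    |∑ i, ∑ j, u i * B i j * v j| ≤ ‖B‖ * √(∑ i, u i ^ 2) * √(∑ j, v j ^ 2) := by
  rw [← inner_toEuclideanLin_eq_sum]
  refine (abs_real_inner_le_norm _ _).trans ?_
  have h := B.l2_opNorm_mulVec (WithLp.toLp 2 v)
  have hu : ‖WithLp.toLp 2 u‖ = √(∑ i, u i ^ 2) := by simp [EuclideanSpace.norm_eq]
  have hv : ‖WithLp.toLp 2 v‖ = √(∑ i, v i ^ 2) := by simp [EuclideanSpace.norm_eq]
  rw [← hu, ← hv]
  calc _ ≤ ‖WithLp.toLp 2 u‖ * (‖B‖ * ‖WithLp.toLp 2 v‖) :=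
        mul_le_mul_of_nonneg_left h (norm_nonneg _)
    _ = _ := by ring

lemma opNorm_le_of_sum_sum_mul_le {B : Matrix ι κ ℝ} {t : ℝ}
    (h : ∀ (u : ι → ℝ) (v : κ → ℝ), ∑ i, u i ^ 2 ≤ 1 → ∑ j, v j ^ 2 ≤ 1 →
      ∑ i, ∑ j, u i * B i j * v j ≤ t) : ‖B‖ ≤ t := by
  have ht : 0 ≤ t := by simpa using h 0 0 (by simp) (by simp)
  rw [Matrix.l2_opNorm_def]
  refine ContinuousLinearMap.opNorm_le_of_unit_norm ht fun v hv => ?_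
  set w : EuclideanSpace ℝ ι := Matrix.toEuclideanLin B v with hw
  change ‖w‖ ≤ t
  -- The optimal test vector is `B v` normalized; for `w = 0` it is the zero vector, so the bound `≤
  -- 1` still holds.
  have hu : ∑ i, ((‖w‖⁻¹ • w) i) ^ 2 ≤ 1 := by
    have h1 : ‖‖w‖⁻¹ • w‖ ≤ 1 := by
      rw [norm_smul, norm_inv, norm_norm]
      exact inv_mul_le_one
    have h2 := EuclideanSpace.norm_sq_eq (‖w‖⁻¹ • w)
    simp only [Real.norm_eq_abs, sq_abs] at h2
    rw [← h2]
    exact pow_le_one₀ (norm_nonneg _) h1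
  have hv' : ∑ j, (v j) ^ 2 ≤ 1 := by
    have h2 := EuclideanSpace.norm_sq_eq v
    simp only [Real.norm_eq_abs, sq_abs] at h2
    rw [← h2, hv, one_pow]
  have h3 := h _ _ hu hv'
  rw [← inner_toEuclideanLin_eq_sum] at h3
  have h4 : inner ℝ (‖w‖⁻¹ • w) w ≤ t := h3
  rw [real_inner_smul_left, real_inner_self_eq_norm_sq] at h4
  rcases eq_or_ne ‖w‖ 0 with h0 | h0
  · rw [h0]; exact ht
  · have : ‖w‖⁻¹ * ‖w‖ ^ 2 = ‖w‖ := by field_simp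
    rwa [this] at h4

/-- The form of `B` at `(u, v)` is at most `t` times that of `P` at `(|u|, |v|)`, and taking
absolute values preserves Euclidean norms. -/
lemma opNorm_le_mul_of_abs_le {B P : Matrix ι κ ℝ} {t : ℝ} (ht : 0 ≤ t)
    (hB : ∀ i j, |B i j| ≤ t * P i j) : ‖B‖ ≤ t * ‖P‖ := by
  refine opNorm_le_of_sum_sum_mul_le fun u v hu hv => ?_
  have h1 : ∑ i, ∑ j, u i * B i j * v j ≤ t * ∑ i, ∑ j, |u i| * P i j * |v j| := by
    rw [Finset.mul_sum]
    refine Finset.sum_le_sum fun i _ => ?_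
    rw [Finset.mul_sum]
    refine Finset.sum_le_sum fun j _ => (le_abs_self _).trans ?_
    rw [abs_mul, abs_mul]
    have := mul_le_mul_of_nonneg_left (hB i j) (mul_nonneg (abs_nonneg (u i)) (abs_nonneg (v j)))
    linarith
  have h2 := (le_abs_self _).trans (abs_sum_sum_mul_le_opNorm P (fun i => |u i|) fun j => |v j|)
  simp only [sq_abs] at h2
  refine h1.trans (mul_le_mul_of_nonneg_left (h2.trans ?_) ht)
  calc ‖P‖ * √(∑ i, u i ^ 2) * √(∑ j, v j ^ 2) ≤ ‖P‖ * 1 * 1 := by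
        gcongr <;> exact Real.sqrt_le_one.2 ‹_›
    _ = ‖P‖ := by ring

lemma sum_sum_le_opNorm (P : Matrix ι κ ℝ) :
    ∑ i, ∑ j, P i j ≤ ‖P‖ * √(Fintype.card ι) * √(Fintype.card κ) := by
  have := (le_abs_self _).trans (abs_sum_sum_mul_le_opNorm P (fun _ => 1) fun _ => 1)
  simpa using this

end OperatorNorm

/-! ### Discretization of the unit ball. -/

section Grid

/-- Rounding goes towards zero, so that rounding a point of the ball does not leave the ball. -/
lemma exists_int_abs_le_abs_and_abs_sub_le (s : ℝ) : ∃ z : ℤ, |(z : ℝ)| ≤ |s| ∧ |s - z| ≤ 1 := by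
  rcases le_total 0 s with h | h
  · refine ⟨⌊s⌋, ?_, ?_⟩
    · rw [abs_of_nonneg h, abs_of_nonneg (by exact_mod_cast Int.floor_nonneg.2 h)]
      exact Int.floor_le s
    · rw [abs_of_nonneg (sub_nonneg.2 (Int.floor_le s))]
      linarith [Int.lt_floor_add_one s]
  · refine ⟨⌈s⌉, ?_, ?_⟩
    · have : (⌈s⌉ : ℝ) ≤ 0 := by exact_mod_cast Int.ceil_nonpos.2 h
      rw [abs_of_nonpos h, abs_of_nonpos this]
      exact neg_le_neg (Int.le_ceil s)
    · rw [abs_of_nonpos (sub_nonpos.2 (Int.le_ceil s))]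
      linarith [Int.ceil_lt_add_one s]

/-- The integer points of the Euclidean ball of radius `k`. -/
noncomputable def ballGrid (m k : ℕ) : Finset (Fin m → ℤ) :=
  {z ∈ Fintype.piFinset fun _ => Finset.Icc (-k : ℤ) k | ∑ i, z i ^ 2 ≤ (k : ℤ) ^ 2}

lemma card_ballGrid_le (m k : ℕ) : (ballGrid m k).card ≤ (2 * k + 1) ^ m := by
  refine (Finset.card_filter_le _ _).trans ?_
  rw [Fintype.card_piFinset_const, Int.card_Icc]
  refine Nat.pow_le_pow_left (by omega) _

lemma sum_div_sq_le_one_of_mem_ballGrid {m k : ℕ} {z : Fin m → ℤ} (hz : z ∈ ballGrid m k) :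
    ∑ i, ((z i : ℝ) / k) ^ 2 ≤ 1 := by
  have h : ∑ i, (z i : ℝ) ^ 2 ≤ (k : ℝ) ^ 2 := by
    exact_mod_cast (Finset.mem_filter.1 hz).2
  simp only [div_pow]
  rw [← Finset.sum_div]
  exact div_le_one_of_le₀ h (by positivity)

lemma exists_mem_ballGrid_near {m k : ℕ} (hk : 0 < k) (hmk : 16 * m ≤ k ^ 2) {u : Fin m → ℝ}
    (hu : ∑ i, u i ^ 2 ≤ 1) :
    ∃ z ∈ ballGrid m k, ∑ i, (u i - z i / k) ^ 2 ≤ (1 / 4) ^ 2 := by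
  have hk' : (0 : ℝ) < k := by exact_mod_cast hk
  choose z hz1 hz2 using fun i => exists_int_abs_le_abs_and_abs_sub_le (k * u i)
  have hsq : ∀ i, (z i : ℝ) ^ 2 ≤ k ^ 2 * u i ^ 2 := fun i => by
    rw [← mul_pow]; exact sq_le_sq.2 (hz1 i)
  have hsum : ∑ i, (z i : ℝ) ^ 2 ≤ (k : ℝ) ^ 2 := by
    calc ∑ i, (z i : ℝ) ^ 2 ≤ ∑ i, (k : ℝ) ^ 2 * u i ^ 2 := Finset.sum_le_sum fun i _ => hsq i
      _ = k ^ 2 * ∑ i, u i ^ 2 := by rw [Finset.mul_sum]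
      _ ≤ k ^ 2 * 1 := by gcongr
      _ = k ^ 2 := mul_one _
  refine ⟨z, Finset.mem_filter.2 ⟨Fintype.mem_piFinset.2 fun i => ?_, by exact_mod_cast hsum⟩, ?_⟩
  · have h1 : (z i : ℝ) ^ 2 ≤ (k : ℝ) ^ 2 :=
      (Finset.single_le_sum (f := fun i => (z i : ℝ) ^ 2) (fun i _ => sq_nonneg _)
        (Finset.mem_univ i)).trans hsum
    have h2 := abs_le_of_sq_le_sq' h1 hk'.le
    rw [Finset.mem_Icc]
    exact ⟨by exact_mod_cast h2.1, by exact_mod_cast h2.2⟩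
  · have h1 : ∀ i, (u i - z i / k) ^ 2 ≤ 1 / (k : ℝ) ^ 2 := by
      intro i
      have : u i - z i / k = (k * u i - z i) / k := by field_simp
      rw [this, div_pow]
      have := (sq_le_one_iff_abs_le_one _).2 (hz2 i)
      gcongr
    calc ∑ i, (u i - z i / k) ^ 2 ≤ ∑ _i : Fin m, 1 / (k : ℝ) ^ 2 :=
          Finset.sum_le_sum fun i _ => h1 i
      _ = m / (k : ℝ) ^ 2 := by simp [div_eq_mul_inv]
      _ ≤ (1 / 4) ^ 2 := by
        rw [div_le_iff₀ (by positivity)]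
        have : (16 * m : ℝ) ≤ (k : ℝ) ^ 2 := by exact_mod_cast hmk
        linarith

/-- The operator norm is controlled by the values of the bilinear form on a grid. -/
lemma opNorm_le_two_mul_of_ballGrid {m n k : ℕ} (hk : 0 < k) (hmk : 16 * m ≤ k ^ 2)
    (hnk : 16 * n ≤ k ^ 2) {B : Matrix (Fin m) (Fin n) ℝ} {t : ℝ}
    (h : ∀ z ∈ ballGrid m k, ∀ z' ∈ ballGrid n k,
      ∑ i, ∑ j, (z i / k : ℝ) * B i j * (z' j / k) ≤ t) : ‖B‖ ≤ 2 * t := by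
  -- Moving each argument to a grid point at distance at most `1 / 4` costs `‖B‖ / 4`, and the total
  -- is absorbed on the left.
  suffices ‖B‖ ≤ t + ‖B‖ / 2 by linarith
  refine opNorm_le_of_sum_sum_mul_le fun u v hu hv => ?_
  obtain ⟨z, hz, hzu⟩ := exists_mem_ballGrid_near hk hmk hu
  obtain ⟨z', hz', hzv⟩ := exists_mem_ballGrid_near hk hnk hv
  have hsplit : ∑ i, ∑ j, u i * B i j * v j =
      ∑ i, ∑ j, (z i / k : ℝ) * B i j * (z' j / k) +
      ∑ i, ∑ j, (u i - z i / k) * B i j * v j +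
      ∑ i, ∑ j, (z i / k : ℝ) * B i j * (v j - z' j / k) := by
    simp only [← Finset.sum_add_distrib]
    exact Finset.sum_congr rfl fun i _ => Finset.sum_congr rfl fun j _ => by ring
  have h4 : ∀ {s : ℝ}, s ≤ (1 / 4) ^ 2 → √s ≤ 1 / 4 := fun hs =>
    Real.sqrt_le_iff.2 ⟨by norm_num, hs⟩
  have h1 : ∑ i, ∑ j, (u i - z i / k) * B i j * v j ≤ ‖B‖ / 4 := by
    refine ((le_abs_self _).trans (abs_sum_sum_mul_le_opNorm B _ _)).trans ?_
    calc _ ≤ ‖B‖ * (1 / 4) * 1 := by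
          gcongr
          · exact h4 hzu
          · exact Real.sqrt_le_one.2 hv
      _ = _ := by ring
  have h2 : ∑ i, ∑ j, (z i / k : ℝ) * B i j * (v j - z' j / k) ≤ ‖B‖ / 4 := by
    refine ((le_abs_self _).trans (abs_sum_sum_mul_le_opNorm B _ _)).trans ?_
    calc _ ≤ ‖B‖ * 1 * (1 / 4) := by
          gcongr
          · exact Real.sqrt_le_one.2 (sum_div_sq_le_one_of_mem_ballGrid hz)
          · exact h4 hzv
      _ = _ := by ring
  rw [hsplit]
  linarith [h z hz z' hz']

end Grid

/-! ### Hoeffding bounds for rows, columns and the operator norm. -/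

section Concentration

variable {Ω : Type*} [MeasurableSpace Ω] {μ : Measure Ω}

lemma hasSubgaussianMGF_mono {X : Ω → ℝ} {c c' : NNReal} (h : HasSubgaussianMGF X c μ)
    (hc : c ≤ c') : HasSubgaussianMGF X c' μ where
  integrable_exp_mul := h.integrable_exp_mul
  mgf_le t := (h.mgf_le t).trans (Real.exp_le_exp.2 (by gcongr))

variable [IsProbabilityMeasure μ]

/-- **Hoeffding's inequality** for linear combinations of independent variables in `[0, b]`. -/
lemma hoeffding_weighted_sum {ι : Type*} [Fintype ι] {X : ι → Ω → ℝ}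
    (hm : ∀ p, Measurable (X p)) (hind : iIndepFun X μ) {b : ℝ} (hb : 0 < b)
    (hX : ∀ p, ∀ᵐ ω ∂μ, X p ω ∈ Set.Icc 0 b) {w : ι → ℝ} {W : ℝ} (hW : 0 < W)
    (hwW : ∑ p, w p ^ 2 ≤ W) {t : ℝ} (ht : 0 ≤ t) :
    μ.real {ω | t * √W ≤ |∑ p, w p * (X p ω - ∫ ω', X p ω' ∂μ)|} ≤
      2 * Real.exp (-(t ^ 2 / b ^ 2)) := by
  set Z : ι → Ω → ℝ := fun p ω => w p * (X p ω - ∫ ω', X p ω' ∂μ) with hZ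
  have hZind : iIndepFun Z μ :=
    hind.comp (fun p z => w p * (z - ∫ ω', X p ω' ∂μ)) fun p => by fun_prop
  -- The variance proxy `b ^ 2 * W / 4` is doubled to give the clean exponent `t ^ 2 / b ^ 2`.
  have hsub : HasSubgaussianMGF (fun ω => ∑ p, Z p ω) (Real.toNNReal (b ^ 2 * W / 2)) μ := by
    have hp : ∀ p, HasSubgaussianMGF (Z p) (Real.toNNReal (w p ^ 2 * (b / 2) ^ 2)) μ := by
      intro p
      refine hasSubgaussianMGF_mono
        ((hasSubgaussianMGF_of_mem_Icc (hm p).aemeasurable (hX p)).const_mul (w p)) ?_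
      refine NNReal.coe_le_coe.1 ?_
      rw [Real.coe_toNNReal _ (by positivity)]
      change w p ^ 2 * (‖b - 0‖ / 2) ^ 2 ≤ _
      rw [sub_zero, Real.norm_of_nonneg hb.le]
    refine hasSubgaussianMGF_mono
      (HasSubgaussianMGF.sum_of_iIndepFun hZind (s := Finset.univ) fun p _ => hp p) ?_
    rw [← Real.toNNReal_sum_of_nonneg fun p _ => by positivity, ← Finset.sum_mul]
    refine Real.toNNReal_le_toNNReal ?_
    have : (∑ p, w p ^ 2) * (b / 2) ^ 2 ≤ W * (b / 2) ^ 2 := by gcongr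
    nlinarith [mul_pos hW (pow_pos hb 2)]
  have htW : 0 ≤ t * √W := by positivity
  have hexp : -(t * √W) ^ 2 / (2 * (Real.toNNReal (b ^ 2 * W / 2) : ℝ)) = -(t ^ 2 / b ^ 2) := by
    rw [Real.coe_toNNReal _ (by positivity), mul_pow, Real.sq_sqrt hW.le]
    field_simp
  have h1 := hsub.measure_ge_le htW
  have h2 := hsub.neg.measure_ge_le htW
  rw [hexp] at h1 h2
  have hsubset : {ω | t * √W ≤ |∑ p, Z p ω|} ⊆
      {ω | t * √W ≤ ∑ p, Z p ω} ∪ {ω | t * √W ≤ (-fun ω => ∑ p, Z p ω) ω} := by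
    intro ω hω
    rcases le_abs.1 (Set.mem_ofPred_eq ▸ hω) with h | h
    · exact Or.inl h
    · exact Or.inr h
  have h3 := (measureReal_mono (μ := μ) hsubset).trans (measureReal_union_le _ _)
  linarith

lemma hoeffding_weighted_sum_finset {ι : Type*} [Fintype ι] {X : ι → Ω → ℝ}
    (hm : ∀ p, Measurable (X p)) (hind : iIndepFun X μ) {b : ℝ} (hb : 0 < b)
    (hX : ∀ p, ∀ᵐ ω ∂μ, X p ω ∈ Set.Icc 0 b) {β : Type*} (s : Finset β) {w : β → ι → ℝ} {W : ℝ}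
    (hW : 0 < W) (hwW : ∀ k ∈ s, ∑ p, w k p ^ 2 ≤ W) {t : ℝ} (ht : 0 ≤ t) :
    μ.real {ω | ∃ k ∈ s, t * √W ≤ |∑ p, w k p * (X p ω - ∫ ω', X p ω' ∂μ)|} ≤
      s.card * (2 * Real.exp (-(t ^ 2 / b ^ 2))) := by
  have h : {ω | ∃ k ∈ s, t * √W ≤ |∑ p, w k p * (X p ω - ∫ ω', X p ω' ∂μ)|} =
      ⋃ k ∈ s, {ω | t * √W ≤ |∑ p, w k p * (X p ω - ∫ ω', X p ω' ∂μ)|} := by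
    ext ω; simp
  rw [h, ← nsmul_eq_mul]
  refine (measureReal_biUnion_finset_le _ _).trans (Finset.sum_le_card_nsmul _ _ _ fun k hk => ?_)
  exact hoeffding_weighted_sum hm hind hb hX hW (hwW k hk) ht

variable {m n : ℕ} {A : Ω → Matrix (Fin m) (Fin n) ℝ}

lemma measureReal_exists_row_le (hm : ∀ i j, Measurable fun ω => A ω i j)
    (hind : iIndepFun (fun (p : Fin m × Fin n) (ω : Ω) => A ω p.1 p.2) μ) {b : ℝ} (hb : 0 < b)
    (hA : ∀ i j, ∀ᵐ ω ∂μ, A ω i j ∈ Set.Icc 0 b) {y : Fin n → ℝ} (hy : 0 < ∑ j, y j ^ 2)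
    {t : ℝ} (ht : 0 ≤ t) :
    μ.real {ω | ∃ i, t * √(∑ j, y j ^ 2) ≤ |∑ j, (A ω - expectation μ A) i j * y j|} ≤
      m * (2 * Real.exp (-(t ^ 2 / b ^ 2))) := by
  have h := hoeffding_weighted_sum_finset (fun p : Fin m × Fin n => hm p.1 p.2) hind hb
    (fun p => hA p.1 p.2) (Finset.univ : Finset (Fin m))
    (w := fun i p => if p.1 = i then y p.2 else 0) hy (fun i _ => ?_) ht
  · rw [Finset.card_univ, Fintype.card_fin] at h
    refine le_trans (le_of_eq ?_) h
    congr 1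
    ext ω
    simp only [Set.mem_ofPred_eq, Finset.mem_univ, true_and]
    refine exists_congr fun i => ?_
    rw [Fintype.sum_prod_type, Finset.sum_eq_single i (fun k _ hk => by simp [hk]) (by simp)]
    simp [expectation, mul_comm]
  · rw [Fintype.sum_prod_type, Finset.sum_eq_single i (fun k _ hk => by simp [hk]) (by simp)]
    simp

lemma measureReal_exists_column_le (hm : ∀ i j, Measurable fun ω => A ω i j)
    (hind : iIndepFun (fun (p : Fin m × Fin n) (ω : Ω) => A ω p.1 p.2) μ) {b : ℝ} (hb : 0 < b)
    (hA : ∀ i j, ∀ᵐ ω ∂μ, A ω i j ∈ Set.Icc 0 b) {x : Fin m → ℝ} (hx : 0 < ∑ i, x i ^ 2)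
    {t : ℝ} (ht : 0 ≤ t) :
    μ.real {ω | ∃ j, t * √(∑ i, x i ^ 2) ≤ |∑ i, (A ω - expectation μ A) i j * x i|} ≤
      n * (2 * Real.exp (-(t ^ 2 / b ^ 2))) := by
  have h := hoeffding_weighted_sum_finset (fun p : Fin m × Fin n => hm p.1 p.2) hind hb
    (fun p => hA p.1 p.2) (Finset.univ : Finset (Fin n))
    (w := fun j p => if p.2 = j then x p.1 else 0) hx (fun j _ => ?_) ht
  · rw [Finset.card_univ, Fintype.card_fin] at h
    refine le_trans (le_of_eq ?_) h
    congr 1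
    ext ω
    simp only [Set.mem_ofPred_eq, Finset.mem_univ, true_and]
    refine exists_congr fun j => ?_
    rw [Fintype.sum_prod_type_right, Finset.sum_eq_single j (fun k _ hk => by simp [hk]) (by simp)]
    simp [expectation, mul_comm]
  · rw [Fintype.sum_prod_type_right, Finset.sum_eq_single j (fun k _ hk => by simp [hk]) (by simp)]
    simp

/-- Union bound over pairs of grid points: each value of the form is a weighted sum of the entries,
and its weights, a product of two vectors in the unit ball, have square sum at most `1`. -/
lemma measureReal_opNorm_le (hm : ∀ i j, Measurable fun ω => A ω i j)
    (hind : iIndepFun (fun (p : Fin m × Fin n) (ω : Ω) => A ω p.1 p.2) μ) {b : ℝ} (hb : 0 < b)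
    (hA : ∀ i j, ∀ᵐ ω ∂μ, A ω i j ∈ Set.Icc 0 b) {k : ℕ} (hk : 0 < k) (hmk : 16 * m ≤ k ^ 2)
    (hnk : 16 * n ≤ k ^ 2) {t : ℝ} (ht : 0 ≤ t) :
    μ.real {ω | 2 * t < ‖A ω - expectation μ A‖} ≤
      (2 * k + 1 : ℝ) ^ (m + n) * (2 * Real.exp (-(t ^ 2 / b ^ 2))) := by
  have h := hoeffding_weighted_sum_finset (fun p : Fin m × Fin n => hm p.1 p.2) hind hb
    (fun p => hA p.1 p.2) (ballGrid m k ×ˢ ballGrid n k)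
    (w := fun z p => (z.1 p.1 / k : ℝ) * (z.2 p.2 / k)) one_pos (fun z hz => ?_) ht
  · have hcard : ((ballGrid m k ×ˢ ballGrid n k).card : ℝ) ≤ (2 * k + 1 : ℝ) ^ (m + n) := by
      rw [Finset.card_product, pow_add]
      exact_mod_cast Nat.mul_le_mul (card_ballGrid_le m k) (card_ballGrid_le n k)
    refine (measureReal_mono fun ω hω => ?_).trans
      (h.trans (mul_le_mul_of_nonneg_right hcard (by positivity)))
    by_contra hcon
    refine (not_le.2 hω) (opNorm_le_two_mul_of_ballGrid hk hmk hnk fun z hz z' hz' => ?_)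
    simp only [Set.mem_ofPred_eq, not_exists, not_and, not_le, Real.sqrt_one, mul_one] at hcon
    refine le_trans (le_of_eq ?_)
      ((le_abs_self _).trans (hcon (z, z') (Finset.mem_product.2 ⟨hz, hz'⟩)).le)
    rw [Fintype.sum_prod_type]
    refine Finset.sum_congr rfl fun i _ => Finset.sum_congr rfl fun j _ => ?_
    simp only [expectation, Matrix.sub_apply, Matrix.of_apply]
    ring
  · rw [Finset.mem_product] at hz
    simp only [mul_pow]
    rw [Fintype.sum_prod_type]
    dsimp only
    rw [← Fintype.sum_mul_sum]
    exact mul_le_one₀ (sum_div_sq_le_one_of_mem_ballGrid hz.1)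
      (Finset.sum_nonneg fun _ _ => sq_nonneg _) (sum_div_sq_le_one_of_mem_ballGrid hz.2)

end Concentration

/-! ### Deterministic comparison of two scaled matrices. -/

section Deterministic

variable {ι κ : Type*} [Fintype ι]

/-- Scaling factors of a matrix with entries in `[a, b]` are balanced if the sums are. -/
lemma column_factor_le_mul [Nonempty ι] {a b C : ℝ} (ha : 0 < a) (hC : 0 ≤ C) {A : ι → κ → ℝ}
    (hA : ∀ i j, A i j ∈ Set.Icc a b) {x : ι → ℝ} {y c : κ → ℝ} (hx : ∀ i, 0 < x i)
    (hy : ∀ j, 0 < y j) (hc : ∀ j, c j = ∑ i, x i * A i j * y j) (hcC : ∀ j k, c j ≤ C * c k)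
    (j k : κ) : y j ≤ b / a * C * y k := by
  have hX : 0 < ∑ i, x i := Finset.sum_pos (fun i _ => hx i) Finset.univ_nonempty
  have h1 : (∑ i, x i) * a * y j ≤ c j := by
    rw [hc, Finset.sum_mul, Finset.sum_mul]
    exact Finset.sum_le_sum fun i _ => mul_le_mul_of_nonneg_right
      (mul_le_mul_of_nonneg_left (hA i j).1 (hx i).le) (hy j).le
  have h2 : c k ≤ (∑ i, x i) * b * y k := by
    rw [hc, Finset.sum_mul, Finset.sum_mul]
    exact Finset.sum_le_sum fun i _ => mul_le_mul_of_nonneg_right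
      (mul_le_mul_of_nonneg_left (hA i k).2 (hx i).le) (hy k).le
  have h3 : (∑ i, x i) * (a * y j) ≤ (∑ i, x i) * (C * b * y k) := by
    have := mul_le_mul_of_nonneg_left h2 hC
    linarith [hcC j k]
  have h4 := le_of_mul_le_mul_left h3 hX
  calc y j = a * y j / a := by field_simp
    _ ≤ C * b * y k / a := by gcongr
    _ = _ := by ring

lemma card_mul_le_of_le_mul {G : ℝ} {x : ι → ℝ} (h : ∀ i k, x i ≤ G * x k) (i : ι) :
    Fintype.card ι * x i ≤ G * ∑ k, x k := by
  have := Finset.card_nsmul_le_sum Finset.univ (fun k => G * x k) (x i) fun k _ => h i k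
  rwa [nsmul_eq_mul, ← Finset.mul_sum, Finset.card_univ] at this

/-- No coordinate exceeds `G` times the mean. This gain of a square root of the dimension in `‖x‖₂`
over `‖x‖₁` produces the decay of the row and column errors. -/
lemma card_mul_sum_sq_le {G : ℝ} {x : ι → ℝ} (hx : ∀ i, 0 < x i) (h : ∀ i k, x i ≤ G * x k) :
    Fintype.card ι * ∑ i, x i ^ 2 ≤ G * (∑ i, x i) ^ 2 := by
  rw [Finset.mul_sum, sq, ← mul_assoc, Finset.mul_sum]
  refine Finset.sum_le_sum fun i _ => ?_
  have := mul_le_mul_of_nonneg_right (card_mul_le_of_le_mul h i) (hx i).le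
  linarith

/-- Relative error of the row sums when `A` is replaced by a matrix `B` for which `(B - A) y` is
small. -/
lemma abs_row_sum_sub_le {ι κ : Type*} [Fintype κ] [Nonempty κ] {a b G δ l : ℝ} (ha : 0 < a)
    (hδ : 0 ≤ δ) (hG : 0 ≤ G) (hl : 0 < l) (hlκ : l ≤ Fintype.card κ) {A B : ι → κ → ℝ}
    (hA : ∀ i j, A i j ∈ Set.Icc a b) {x r : ι → ℝ}
    {y : κ → ℝ} (hx : ∀ i, 0 < x i) (hy : ∀ j, 0 < y j) (hyG : ∀ j k, y j ≤ G * y k)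
    (hr : ∀ i, r i = ∑ j, x i * A i j * y j)
    (h : ∀ i, |∑ j, (B i j - A i j) * y j| ≤ δ * √(∑ j, y j ^ 2)) (i : ι) :
    |∑ j, x i * B i j * y j - r i| ≤ δ / a * √(G / l) * r i := by
  have hY : 0 < ∑ j, y j := Finset.sum_pos (fun j _ => hy j) Finset.univ_nonempty
  have h1 : ∑ j, x i * B i j * y j - r i = x i * ∑ j, (B i j - A i j) * y j := by
    rw [hr, Finset.mul_sum, ← Finset.sum_sub_distrib]
    exact Finset.sum_congr rfl fun j _ => by ring
  have h2 : √(∑ j, y j ^ 2) ≤ √(G / l) * ∑ j, y j := by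
    rw [← Real.sqrt_sq hY.le, ← Real.sqrt_mul (by positivity)]
    refine Real.sqrt_le_sqrt ?_
    rw [div_mul_eq_mul_div, le_div_iff₀ hl, mul_comm]
    exact (mul_le_mul_of_nonneg_right hlκ (Finset.sum_nonneg fun _ _ => sq_nonneg _)).trans
      (card_mul_sum_sq_le hy hyG)
  have h3 : x i * a * ∑ j, y j ≤ r i := by
    rw [hr, Finset.mul_sum]
    exact Finset.sum_le_sum fun j _ => mul_le_mul_of_nonneg_right
      (mul_le_mul_of_nonneg_left (hA i j).1 (hx i).le) (hy j).le
  rw [h1, abs_mul, abs_of_pos (hx i)]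
  calc x i * |∑ j, (B i j - A i j) * y j| ≤ x i * (δ * (√(G / l) * ∑ j, y j)) :=
        mul_le_mul_of_nonneg_left ((h i).trans (mul_le_mul_of_nonneg_left h2 hδ)) (hx i).le
    _ = δ / a * √(G / l) * (x i * a * ∑ j, y j) := by field_simp
    _ ≤ _ := mul_le_mul_of_nonneg_left h3 (by positivity)

/-- The constant in the comparison of two scaled matrices. -/
noncomputable def comparisonConst (a b C : ℝ) : ℝ :=
  3 * (b / a) ^ 6 * √(b / a * C) + 4 * (b / a) ^ 3 * C ^ 2

/-- Deterministic comparison of the scaled matrices of `A` and `B` in terms of the size of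
`B - A`. -/
theorem opNorm_scaled_sub_le {m n : ℕ} (hm : 0 < m) (hn : 0 < n) {a b C τ : ℝ} (ha : 0 < a)
    (hC : 0 ≤ C) (hτ : 0 ≤ τ) {A B : Matrix (Fin m) (Fin n) ℝ}
    (hA : ∀ i j, A i j ∈ Set.Icc a b) (hB : ∀ i j, B i j ∈ Set.Icc a b)
    {x x' r : Fin m → ℝ} {y y' c : Fin n → ℝ}
    (hx : ∀ i, 0 < x i) (hx' : ∀ i, 0 < x' i) (hy : ∀ j, 0 < y j) (hy' : ∀ j, 0 < y' j)
    (hs : Scales x y A r c) (hs' : Scales x' y' B r c)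
    (hrC : ∀ i k, r i ≤ C * r k) (hcC : ∀ j k, c j ≤ C * c k)
    (hrow : ∀ i, |∑ j, (B - A) i j * y j| ≤ b * τ * √(∑ j, y j ^ 2))
    (hcol : ∀ j, |∑ i, (B - A) i j * x i| ≤ b * τ * √(∑ i, x i ^ 2))
    (hop : ‖B - A‖ ≤ 4 * b * τ * √(max m n : ℕ)) :
    ‖Matrix.diagonal x' * B * Matrix.diagonal y' - Matrix.diagonal x * A * Matrix.diagonal y‖ ≤
      comparisonConst a b C * (τ / √(min m n : ℕ)) *
        ‖Matrix.diagonal x * A * Matrix.diagonal y‖ := by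
  have : Nonempty (Fin m) := ⟨⟨0, hm⟩⟩
  have : Nonempty (Fin n) := ⟨⟨0, hn⟩⟩
  have hb : 0 < b := ha.trans_le ((hA ⟨0, hm⟩ ⟨0, hn⟩).1.trans (hA ⟨0, hm⟩ ⟨0, hn⟩).2)
  set β := b / a with hβ
  have hβ0 : 0 < β := by positivity
  set l : ℝ := ((min m n : ℕ) : ℝ) with hl
  set L : ℝ := ((max m n : ℕ) : ℝ) with hL
  have hl0 : 0 < l := by rw [hl]; exact_mod_cast lt_min hm hn
  have hL0 : 0 < L := by rw [hL]; exact_mod_cast lt_max_of_lt_left hm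
  have hlm : l ≤ m := by rw [hl]; exact_mod_cast min_le_left m n
  have hln : l ≤ n := by rw [hl]; exact_mod_cast min_le_right m n
  have hlL : l * L = m * n := by rw [hl, hL]; exact_mod_cast min_mul_max m n
  set P := Matrix.diagonal x * A * Matrix.diagonal y with hP
  set Q := Matrix.diagonal x * B * Matrix.diagonal y with hQ
  have hyG : ∀ j k, y j ≤ β * C * y k := column_factor_le_mul ha hC hA hx hy hs.2 hcC
  have hxG : ∀ i k, x i ≤ β * C * x k :=
    column_factor_le_mul ha hC (A := fun j i => A i j) (fun j i => hA i j) hy hx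
      (fun i => (hs.1 i).trans (Finset.sum_congr rfl fun j _ => by ring)) hrC
  have hG : 0 ≤ β * C := by positivity
  set ε := b * τ / a * √(β * C / l) with hε
  have hε0 : 0 ≤ ε := by positivity
  have herow : ∀ i, |∑ j, x i * B i j * y j - r i| ≤ ε * r i :=
    abs_row_sum_sub_le ha (by positivity) hG hl0 (by simpa using hln) hA hx hy hyG hs.1 hrow
  have hecol : ∀ j, |∑ i, x i * B i j * y j - c j| ≤ ε * c j := by
    intro j
    have := abs_row_sum_sub_le (A := fun j i => A i j) (B := fun j i => B i j) (r := c) ha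
      (by positivity) hG hl0 (by simpa using hlm) (fun j i => hA i j) hy hx hxG
      (fun j => (hs.2 j).trans (Finset.sum_congr rfl fun i _ => by ring)) hcol j
    rwa [Finset.sum_congr rfl fun i _ => (by ring : y j * B i j * x i = x i * B i j * y j)] at this
  have hstab := scaling_stability ha hA hB hx hx' hy hy' hs.1 hs.2 hs'.1 hs'.2 herow hecol
  have h1 : ‖Matrix.diagonal x' * B * Matrix.diagonal y' - Q‖ ≤ 3 * β ^ 5 * ε * ‖P‖ := by
    refine opNorm_le_mul_of_abs_le (by positivity) fun i j => ?_
    simp only [hQ, hP, Matrix.sub_apply, Matrix.mul_diagonal, Matrix.diagonal_mul]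
    have hBpos := ha.trans_le (hB i j).1
    have hBA : B i j ≤ β * A i j := by
      calc B i j ≤ b := (hB i j).2
        _ = β * a := by rw [hβ]; field_simp
        _ ≤ _ := mul_le_mul_of_nonneg_left (hA i j).1 hβ0.le
    have e : x' i * B i j * y' j - x i * B i j * y j = B i j * (x' i * y' j - x i * y j) := by ring
    rw [e, abs_mul, abs_of_pos hBpos]
    calc B i j * |x' i * y' j - x i * y j| ≤ (β * A i j) * (3 * β ^ 4 * ε * (x i * y j)) :=
          mul_le_mul hBA (hstab i j) (abs_nonneg _) (hBpos.le.trans hBA)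
      _ = _ := by ring
  set X := ∑ i, x i with hX
  set Y := ∑ j, y j with hY
  have hX0 : 0 < X := Finset.sum_pos (fun i _ => hx i) Finset.univ_nonempty
  have hY0 : 0 < Y := Finset.sum_pos (fun j _ => hy j) Finset.univ_nonempty
  have hm' : (0 : ℝ) < m := by exact_mod_cast hm
  have hn' : (0 : ℝ) < n := by exact_mod_cast hn
  have hPlow : a * (X * Y) ≤ ‖P‖ * √m * √n := by
    have h := sum_sum_le_opNorm P
    simp only [Fintype.card_fin] at h
    refine le_trans ?_ h
    rw [hX, hY, Finset.sum_mul_sum, Finset.mul_sum]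
    refine Finset.sum_le_sum fun i _ => ?_
    rw [Finset.mul_sum]
    refine Finset.sum_le_sum fun j _ => ?_
    simp only [hP, Matrix.mul_diagonal, Matrix.diagonal_mul]
    have := mul_le_mul_of_nonneg_right (hA i j).1 (mul_pos (hx i) (hy j)).le
    linarith
  -- Here `‖x‖` is the sup norm, which is the operator norm of `Matrix.diagonal x`.
  have hxn : ‖x‖ ≤ β * C * X / m := by
    refine (pi_norm_le_iff_of_nonneg (by positivity)).2 fun i => ?_
    rw [Real.norm_of_nonneg (hx i).le, le_div_iff₀ hm', mul_comm]
    simpa using card_mul_le_of_le_mul hxG i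
  have hyn : ‖y‖ ≤ β * C * Y / n := by
    refine (pi_norm_le_iff_of_nonneg (by positivity)).2 fun j => ?_
    rw [Real.norm_of_nonneg (hy j).le, le_div_iff₀ hn', mul_comm]
    simpa using card_mul_le_of_le_mul hyG j
  have h2 : ‖Q - P‖ ≤ 4 * β ^ 3 * C ^ 2 * (τ / √l) * ‖P‖ := by
    have e : Q - P = Matrix.diagonal x * (B - A) * Matrix.diagonal y := by
      rw [hQ, hP, Matrix.mul_sub, Matrix.sub_mul]
    have hsqrt : √m * √n = √l * √L := by
      rw [← Real.sqrt_mul hm'.le, ← Real.sqrt_mul hl0.le, hlL]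
    have hsq : √l * √l * (√L * √L) = m * n := by
      rw [Real.mul_self_sqrt hl0.le, Real.mul_self_sqrt hL0.le, hlL]
    have hsl : 0 < √l := Real.sqrt_pos.2 hl0
    have hsL : 0 < √L := Real.sqrt_pos.2 hL0
    rw [e]
    calc ‖Matrix.diagonal x * (B - A) * Matrix.diagonal y‖
        ≤ ‖x‖ * ‖B - A‖ * ‖y‖ := by
          refine (Matrix.l2_opNorm_mul _ _).trans ?_
          rw [Matrix.l2_opNorm_diagonal]
          refine mul_le_mul_of_nonneg_right ?_ (norm_nonneg _)
          refine (Matrix.l2_opNorm_mul _ _).trans ?_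
          rw [Matrix.l2_opNorm_diagonal]
      _ ≤ (β * C * X / m) * (4 * b * τ * √L) * (β * C * Y / n) := by gcongr
      _ = 4 * β ^ 3 * C ^ 2 * τ * √L / (m * n) * (a * (X * Y)) := by
          rw [hβ]; field_simp
      _ ≤ 4 * β ^ 3 * C ^ 2 * τ * √L / (m * n) * (‖P‖ * √m * √n) := by gcongr
      _ = 4 * β ^ 3 * C ^ 2 * (τ / √l) * ‖P‖ := by
          rw [mul_assoc ‖P‖, hsqrt, ← hsq]; field_simp
  have h3 : 3 * β ^ 5 * ε = 3 * β ^ 6 * √(β * C) * (τ / √l) := by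
    rw [hε, Real.sqrt_div hG, hβ]; ring
  rw [h3] at h1
  calc _ ≤ _ := norm_sub_le_norm_sub_add_norm_sub _ Q _
    _ ≤ _ := add_le_add h1 h2
    _ = _ := by rw [comparisonConst]; ring

end Deterministic

lemma nonneg_and_le_mul_of_iSup_div_iInf_le {ι : Type*} [Finite ι] [Nonempty ι] {r : ι → ℝ}
    (hr : ∀ i, 0 < r i) {C : ℝ} (hC : (⨆ i, r i) / (⨅ i, r i) ≤ C) :
    0 ≤ C ∧ ∀ i k, r i ≤ C * r k := by
  have hinf : 0 < ⨅ i, r i := by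
    obtain ⟨i, hi⟩ := exists_eq_ciInf_of_finite (f := r)
    rw [← hi]; exact hr i
  have hle : ∀ i, r i ≤ ⨆ i, r i := le_ciSup (Set.finite_range r).bddAbove
  have hge : ∀ i, ⨅ i, r i ≤ r i := ciInf_le (Set.finite_range r).bddBelow
  have hC0 : 0 ≤ C := by
    obtain ⟨i⟩ := ‹Nonempty ι›
    exact (div_nonneg ((hr i).le.trans (hle i)) hinf.le).trans hC
  refine ⟨hC0, fun i k => ?_⟩
  rw [div_le_iff₀ hinf] at hC
  exact (hle i).trans (hC.trans (mul_le_mul_of_nonneg_left (hge k) hC0))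

/-! ### Probability bounds at a fixed size. -/

section FixedSize

variable {Ω : Type*} [MeasurableSpace Ω] {μ : Measure Ω} [IsProbabilityMeasure μ] {m n : ℕ}
  {A : Ω → Matrix (Fin m) (Fin n) ℝ} {a b : ℝ}

lemma expectation_mem_Icc (hm : ∀ i j, Measurable fun ω => A ω i j)
    (hA : ∀ i j, ∀ᵐ ω ∂μ, A ω i j ∈ Set.Icc a b) (i : Fin m) (j : Fin n) :
    expectation μ A i j ∈ Set.Icc a b := by
  have hint : Integrable (fun ω => A ω i j) μ :=
    Integrable.of_mem_Icc a b (hm i j).aemeasurable (hA i j)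
  constructor
  · have := integral_mono_ae (integrable_const a) hint ((hA i j).mono fun ω h => h.1)
    simpa [expectation] using this
  · have := integral_mono_ae hint (integrable_const b) ((hA i j).mono fun ω h => h.2)
    simpa [expectation] using this

/-- The operator norm of the centred matrix is `O(√(L log L))`, `L = max m n`, with high
probability. -/
lemma measureReal_opNorm_sub_expectation_le (hmeas : ∀ i j, Measurable fun ω => A ω i j)
    (hind : iIndepFun (fun (p : Fin m × Fin n) (ω : Ω) => A ω p.1 p.2) μ) (hb : 0 < b)
    (hA : ∀ i j, ∀ᵐ ω ∂μ, A ω i j ∈ Set.Icc 0 b) {L : ℕ} (hmL : m ≤ L) (hnL : n ≤ L)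
    (hL : 9 ≤ L) :
    μ.real {ω | 4 * b * √(2 * Real.log L) * √L < ‖A ω - expectation μ A‖} ≤ 2 / L := by
  have hL' : (9 : ℝ) ≤ L := by exact_mod_cast hL
  have hlog : 0 ≤ Real.log L := Real.log_nonneg (by linarith)
  -- The grid pairs number at most `L ^ (4 * L)`, which the tail `2 * L ^ (-6 * L)` beats; the
  -- threshold fits because `2 * √6 ≤ 4 * √2`.
  set t := b * √(6 * L * Real.log L) with ht
  have ht2 : t ^ 2 / b ^ 2 = ((6 * L : ℕ) : ℝ) * Real.log L := by
    rw [ht, mul_pow, Real.sq_sqrt (by positivity)]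
    push_cast
    field_simp
  have h4 : 2 * t ≤ 4 * b * √(2 * Real.log L) * √L := by
    have : √(6 * L * Real.log L) ≤ 2 * (√(2 * Real.log L) * √L) := by
      rw [← Real.sqrt_mul (by positivity)]
      refine Real.sqrt_le_iff.2 ⟨by positivity, ?_⟩
      rw [mul_pow, Real.sq_sqrt (by positivity)]
      have : 0 ≤ L * Real.log L := by positivity
      linarith
    rw [ht]
    have := mul_le_mul_of_nonneg_left this hb.le
    linarith
  have h := measureReal_opNorm_le hmeas hind hb hA (k := 4 * L) (by omega) (by nlinarith)
    (by nlinarith) (t := t) (by positivity)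
  refine (measureReal_mono fun ω hω => lt_of_le_of_lt h4 hω).trans (h.trans ?_)
  rw [ht2, Real.exp_neg, Real.exp_nat_mul, Real.exp_log (by linarith)]
  -- For natural `L > 0`, the inequality `8 * L + 1 ≤ L ^ 2` first holds at `L = 9`.
  have h1 : (2 * ((4 * L : ℕ) : ℝ) + 1) ^ (m + n) ≤ (L : ℝ) ^ (4 * L) := by
    calc (2 * ((4 * L : ℕ) : ℝ) + 1) ^ (m + n) ≤ ((L : ℝ) ^ 2) ^ (m + n) := by
          gcongr; push_cast; nlinarith
      _ ≤ ((L : ℝ) ^ 2) ^ (2 * L) := pow_le_pow_right₀ (by nlinarith) (by omega)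
      _ = _ := by rw [← pow_mul]; congr 1; ring
  have h2 : (L : ℝ) ^ (4 * L) * L ≤ (L : ℝ) ^ (6 * L) := by
    rw [← pow_succ]
    exact pow_le_pow_right₀ (by linarith) (by omega)
  have hL0 : (0 : ℝ) < L := by linarith
  calc _ ≤ (L : ℝ) ^ (4 * L) * (2 * ((L : ℝ) ^ (6 * L))⁻¹) := by gcongr
    _ = 2 * ((L : ℝ) ^ (4 * L) / (L : ℝ) ^ (6 * L)) := by ring
    _ ≤ 2 * (1 / L) := by
        refine mul_le_mul_of_nonneg_left ?_ zero_le_two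
        rw [div_le_div_iff₀ (by positivity) hL0, one_mul]
        exact h2
    _ = 2 / L := by ring

/-- The concentration bound for matrices of fixed size. -/
theorem measure_not_relative_error_le (hm : 0 < m) (hn : 0 < n) (hL : 9 ≤ max m n)
    (hmeas : ∀ i j, Measurable fun ω => A ω i j)
    (hind : iIndepFun (fun (p : Fin m × Fin n) (ω : Ω) => A ω p.1 p.2) μ) (ha : 0 < a)
    (hA : ∀ i j, ∀ᵐ ω ∂μ, A ω i j ∈ Set.Icc a b) {r : Fin m → ℝ} {c : Fin n → ℝ} {C : ℝ}
    (hC : 0 ≤ C) (hrC : ∀ i k, r i ≤ C * r k) (hcC : ∀ j k, c j ≤ C * c k)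
    {P : Matrix (Fin m) (Fin n) ℝ} {Pt : Ω → Matrix (Fin m) (Fin n) ℝ}
    (hP : IsScaledMatrix (expectation μ A) r c P)
    (hPt : ∀ᵐ ω ∂μ, IsScaledMatrix (A ω) r c (Pt ω)) :
    μ {ω | ¬ ‖Pt ω - P‖ / ‖P‖ ≤ comparisonConst a b C * √2 *
      √(Real.log (max m n : ℕ) / (min m n : ℕ))} ≤ ENNReal.ofReal (6 / (max m n : ℕ)) := by
  obtain ⟨x, y, hx, hy, hs, rfl⟩ := hP
  have hE := expectation_mem_Icc hmeas hA
  have hb : 0 < b := ha.trans_le ((hE ⟨0, hm⟩ ⟨0, hn⟩).1.trans (hE ⟨0, hm⟩ ⟨0, hn⟩).2)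
  have hA0 : ∀ i j, ∀ᵐ ω ∂μ, A ω i j ∈ Set.Icc 0 b := fun i j =>
    (hA i j).mono fun ω h => ⟨ha.le.trans h.1, h.2⟩
  set L := max m n with hLdef
  have hL' : (9 : ℝ) ≤ L := by exact_mod_cast hL
  have hL0 : (0 : ℝ) < L := by linarith
  have hlog : 0 ≤ Real.log L := Real.log_nonneg (by linarith)
  -- With this `τ` each single tail is `2 / L ^ 2`, so a union over at most `L` rows or columns
  -- costs `2 / L`.
  set τ := √(2 * Real.log L) with hτ
  have hτ0 : 0 ≤ τ := Real.sqrt_nonneg _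
  have hy2 : 0 < ∑ j, y j ^ 2 := Finset.sum_pos (fun j _ => pow_pos (hy j) 2) ⟨⟨0, hn⟩, by simp⟩
  have hx2 : 0 < ∑ i, x i ^ 2 := Finset.sum_pos (fun i _ => pow_pos (hx i) 2) ⟨⟨0, hm⟩, by simp⟩
  have htail : ∀ k : ℕ, k ≤ L → k * (2 * Real.exp (-((b * τ) ^ 2 / b ^ 2))) ≤ 2 / L := by
    intro k hk
    have e : (b * τ) ^ 2 / b ^ 2 = (2 : ℕ) * Real.log L := by
      rw [mul_pow, hτ, Real.sq_sqrt (by positivity)]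
      push_cast
      field_simp
    rw [e, Real.exp_neg, Real.exp_nat_mul, Real.exp_log hL0]
    have hk' : (k : ℝ) ≤ L := by exact_mod_cast hk
    calc (k : ℝ) * (2 * ((L : ℝ) ^ 2)⁻¹) ≤ L * (2 * ((L : ℝ) ^ 2)⁻¹) := by gcongr
      _ = 2 / L := by field_simp
  have hrow := (measureReal_exists_row_le hmeas hind hb hA0 hy2 (t := b * τ) (by positivity)).trans
    (htail m (le_max_left _ _))
  have hcol := (measureReal_exists_column_le hmeas hind hb hA0 hx2 (t := b * τ)
    (by positivity)).trans (htail n (le_max_right _ _))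
  have hop := measureReal_opNorm_sub_expectation_le hmeas hind hb hA0 (le_max_left m n)
    (le_max_right m n) hL
  set S₁ := {ω | ∃ i, b * τ * √(∑ j, y j ^ 2) ≤ |∑ j, (A ω - expectation μ A) i j * y j|}
  set S₂ := {ω | ∃ j, b * τ * √(∑ i, x i ^ 2) ≤ |∑ i, (A ω - expectation μ A) i j * x i|}
  set S₃ := {ω | 4 * b * √(2 * Real.log L) * √L < ‖A ω - expectation μ A‖}
  have hAall : ∀ᵐ ω ∂μ, ∀ i j, A ω i j ∈ Set.Icc a b := by
    simpa only [ae_all_iff] using hA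
  refine (measure_mono_ae (t := S₁ ∪ S₂ ∪ S₃) ?_).trans ?_
  · filter_upwards [hAall, hPt] with ω hAω hPω hω
    by_contra hcon
    replace hcon : ω ∉ S₁ ∪ S₂ ∪ S₃ := hcon
    refine hω ?_
    simp only [S₁, S₂, S₃, Set.mem_union, Set.mem_ofPred_eq, not_or, not_exists, not_le,
      not_lt] at hcon
    obtain ⟨⟨h1, h2⟩, h3⟩ := hcon
    obtain ⟨x', y', hx', hy', hs', e⟩ := hPω
    rw [e]
    have hmain := opNorm_scaled_sub_le hm hn ha hC hτ0 hE hAω hx hx' hy hy' hs hs' hrC hcC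
      (fun i => (h1 i).le) (fun j => (h2 j).le) h3
    have hK : 0 ≤ comparisonConst a b C := by unfold comparisonConst; positivity
    refine div_le_of_le_mul₀ (norm_nonneg _) (by positivity) (hmain.trans (le_of_eq ?_))
    rw [hτ, Real.sqrt_mul (by norm_num), Real.sqrt_div hlog]
    ring
  · rw [← ofReal_measureReal]
    refine ENNReal.ofReal_le_ofReal ?_
    have h1 := measureReal_union_le (μ := μ) (S₁ ∪ S₂) S₃
    have h2 := measureReal_union_le (μ := μ) S₁ S₂
    calc _ ≤ 2 / (L : ℝ) + 2 / L + 2 / L := by linarith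
      _ = 6 / L := by ring

end FixedSize

end RandomScaling

/-! ### The asymptotic statement. -/

theorem mainTheorem6 {Ω : ℕ → Type*} [∀ N, MeasurableSpace (Ω N)]
    (μ : ∀ N, Measure (Ω N)) [∀ N, IsProbabilityMeasure (μ N)]
    (N₀ : ℕ) (hN₀ : 0 < N₀)
    (M : ℕ → ℕ) (hM : Tendsto M atTop atTop)
    -- the random matrices, of size `M N × N`
    (At : ∀ N, Ω N → Matrix (Fin (M N)) (Fin N) ℝ)
    (hmeas : ∀ N ≥ N₀, ∀ i j, Measurable fun ω => At N ω i j)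
    (hindep : ∀ N ≥ N₀,
      iIndepFun (fun (p : Fin (M N) × Fin N) (ω : Ω N) => At N ω p.1 p.2) (μ N))
    (a b : ℝ) (ha : 0 < a)
    (hbound : ∀ N ≥ N₀, ∀ i j, ∀ᵐ ω ∂(μ N), At N ω i j ∈ Set.Icc a b)
    -- the prescribed row and column sums
    (r : ∀ N, Fin (M N) → ℝ) (c : ∀ N, Fin N → ℝ)
    (hr : ∀ N ≥ N₀, ∀ i, 0 < r N i) (hc : ∀ N ≥ N₀, ∀ j, 0 < c N j)
    (hrc : ∀ N ≥ N₀, ∑ i, r N i = ∑ j, c N j)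
    (C : ℝ)
    (hrC : ∀ N ≥ N₀, (⨆ i, r N i) / (⨅ i, r N i) ≤ C)
    (hcC : ∀ N ≥ N₀, (⨆ j, c N j) / (⨅ j, c N j) ≤ C) :
    -- the scaled matrices are well defined
    (∀ N ≥ N₀, ∃! P, RandomScaling.IsScaledMatrix
      (RandomScaling.expectation (μ N) (At N)) (r N) (c N) P) ∧
    (∀ N ≥ N₀, ∀ᵐ ω ∂(μ N), ∃! P, RandomScaling.IsScaledMatrix (At N ω) (r N) (c N) P) ∧
    -- and satisfy the bound
    ∀ (P : ∀ N, Matrix (Fin (M N)) (Fin N) ℝ) (Pt : ∀ N, Ω N → Matrix (Fin (M N)) (Fin N) ℝ),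
      (∀ N ≥ N₀, RandomScaling.IsScaledMatrix
        (RandomScaling.expectation (μ N) (At N)) (r N) (c N) (P N)) →
      (∀ N ≥ N₀, ∀ᵐ ω ∂(μ N), RandomScaling.IsScaledMatrix (At N ω) (r N) (c N) (Pt N ω)) →
      RandomScaling.IsBigOWhp μ (fun N ω => ‖Pt N ω - P N‖ / ‖P N‖)
        (fun N => Real.sqrt (Real.log ((max (M N) N : ℕ) : ℝ) / ((min (M N) N : ℕ) : ℝ))) := by
  have hMpos : ∀ N ≥ N₀, 0 < M N := by
    intro N hN
    by_contra h0
    have hN' : Nonempty (Fin N) := ⟨⟨0, hN₀.trans_le hN⟩⟩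
    have hempty : IsEmpty (Fin (M N)) := by
      rw [Nat.eq_zero_of_not_pos h0]; infer_instance
    have hpos : 0 < ∑ j, c N j := Finset.sum_pos (fun j _ => hc N hN j) Finset.univ_nonempty
    rw [← hrc N hN, Finset.univ_eq_empty, Finset.sum_empty] at hpos
    exact lt_irrefl _ hpos
  refine ⟨fun N hN => ?_, fun N hN => ?_, fun P Pt hP hPt => ?_⟩
  · exact RandomScaling.existsUnique_isScaledMatrix (hMpos N hN) ha
      (RandomScaling.expectation_mem_Icc (hmeas N hN) (hbound N hN)) (hr N hN) (hc N hN) (hrc N hN)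
  · have hall : ∀ᵐ ω ∂(μ N), ∀ i j, At N ω i j ∈ Set.Icc a b := by
      simpa only [ae_all_iff] using hbound N hN
    filter_upwards [hall] with ω hω
    exact RandomScaling.existsUnique_isScaledMatrix (hMpos N hN) ha hω (hr N hN) (hc N hN)
      (hrc N hN)
  · refine ⟨RandomScaling.comparisonConst a b C * √2, ?_⟩
    have hlow : Tendsto (fun N : ℕ => 1 - ENNReal.ofReal (6 / (N : ℝ))) atTop (𝓝 1) := by
      have h1 : Tendsto (fun N : ℕ => ENNReal.ofReal (6 / (N : ℝ))) atTop (𝓝 0) := by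
        simpa using ENNReal.tendsto_ofReal (tendsto_const_div_atTop_nhds_zero_nat (6 : ℝ))
      simpa using ENNReal.Tendsto.sub tendsto_const_nhds h1 (Or.inl ENNReal.one_ne_top)
    refine tendsto_of_tendsto_of_tendsto_of_le_of_le' hlow tendsto_const_nhds ?_
      (Eventually.of_forall fun N => prob_le_one)
    filter_upwards [eventually_ge_atTop N₀, eventually_ge_atTop 9] with N hN hN9
    have hNpos : 0 < N := hN₀.trans_le hN
    have : Nonempty (Fin N) := ⟨⟨0, hNpos⟩⟩
    have : Nonempty (Fin (M N)) := ⟨⟨0, hMpos N hN⟩⟩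
    obtain ⟨hC, hr'⟩ := RandomScaling.nonneg_and_le_mul_of_iSup_div_iInf_le (hr N hN) (hrC N hN)
    obtain ⟨-, hc'⟩ := RandomScaling.nonneg_and_le_mul_of_iSup_div_iInf_le (hc N hN) (hcC N hN)
    have hbad := RandomScaling.measure_not_relative_error_le (hMpos N hN) hNpos
      (hN9.trans (le_max_right _ _)) (hmeas N hN) (hindep N hN) ha (hbound N hN) hC hr' hc'
      (hP N hN) (hPt N hN)
    have hmono : ENNReal.ofReal (6 / ((max (M N) N : ℕ) : ℝ)) ≤ ENNReal.ofReal (6 / (N : ℝ)) := by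
      refine ENNReal.ofReal_le_ofReal ?_
      have h1 : (0 : ℝ) < N := by exact_mod_cast hNpos
      have h2 : (N : ℝ) ≤ (max (M N) N : ℕ) := by exact_mod_cast le_max_right _ _
      gcongr
    rw [tsub_le_iff_right]
    refine le_trans ?_ (add_le_add_right (hbad.trans hmono) _)
    -- Subadditivity replaces the complement rule, as `Pt` is not assumed measurable.
    refine le_trans (le_of_eq (measure_univ (μ := μ N)).symm) (le_trans (measure_mono ?_)
      (measure_union_le _ _))
    intro ω _
    exact em _
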